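/- Let $Q\to\mathbb R$ be a smooth ($C^\infty$) locally trivial fibre bundle whose typical fibre $M$ is a manifold of dimension $m$, with bundle coordinates $(t,q^i)$, where $t$ is the Cartesian coordinate of $\mathbb R$. Let $J^1Q$ be its first order jet manifold, with adapted coordinates $(t,q^i,q^i_t)$, identified with $\{v\in TQ : dt(v)=1\}$, and put $\partial_i=\partial/\partial q^i$, $\partial^t_i=\partial/\partial q^i_t$. Write $VJ^1Q$ and $V_QJ^1Q$ for the vertical tangent bundles of $J^1Q\to\mathbb R$ and of $J^1Q\to Q$. Summation over repeated indices is understood. A holonomic connection on $J^1Q\to\mathbb R$ is a connection with values in $J^2Q$, i.e. a smooth vector field on $J^1Q$ of the form $\xi=\partial_t+q^i_t\partial_i+\xi^i\partial^t_i$. A dynamic connection is a (smooth, in general nonlinear) connection on the affine jet bundle $J^1Q\to Q$, $$\gamma=dt\otimes(\partial_t+\gamma^i_0\partial^t_i)+dq^j\otimes(\partial_j+\gamma^i_j\partial^t_i).$$ It is called symmetric if $\gamma^k_i=\partial^t_i\gamma^k_0+q^j_t\,\partial^t_i\gamma^k_j$ in all bundle coordinates, and it defines the holonomic connection $\xi_\gamma=\partial_t+q^i_t\partial_i+(\gamma^i_0+q^j_t\gamma^i_j)\partial^t_i$.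 Let $\widehat v$ be the canonical endomorphism of $TJ^1Q$ with $\widehat v(\partial_t)=-q^i_t\partial^t_i$, $\widehat v(\partial_i)=\partial^t_i$, $\widehat v(\partial^t_i)=0$. Then the following hold. 1. Every holonomic connection $\xi$ on $J^1Q\to\mathbb R$ yields a dynamic connection $\gamma_\xi$ on $J^1Q\to Q$, given in all bundle coordinates by $$\gamma_\xi=dt\otimes\bigl[\partial_t+(\xi^i-\tfrac12 q^j_t\,\partial^t_j\xi^i)\,\partial^t_i\bigr]+dq^j\otimes\bigl[\partial_j+\tfrac12\,\partial^t_j\xi^i\,\partial^t_i\bigr].$$ 2. There is a unique fibrewise linear endomorphism $I_\xi$ of $VJ^1Q$ over the identity such that $I_\xi(u)=[\xi,\widehat v(u)]-\widehat v([\xi,u])$ for all local smooth sections $u$ of $VJ^1Q$. With $J_\xi=\tfrac12(I_\xi+\mathrm{Id})$ and $\widehat\xi:TJ^1Q\to VJ^1Q$, $\widehat\xi(w)=w-dt(w)\,\xi$, the projection of $TJ^1Q$ onto $V_QJ^1Q$ along the horizontal subbundle of $\gamma_\xi$ is $J_\xi\circ\widehat\xi$. 3. The dynamic connection $\gamma_\xi$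 is symmetric. 4. A dynamic connection $\gamma$ satisfies $\gamma=\gamma_{\xi_\gamma}$ if and only if $\gamma$ is symmetric. -/

import Mathlib

open Set Filter Topology Bundle
open scoped Manifold ContDiff

noncomputable section

namespace TimeMech

/-- The model of the fibre. -/
abbrev Fib (m : ℕ) : Type := EuclideanSpace ℝ (Fin m)

/-- The coordinate space of `(t, q^i)`. -/
abbrev Base (m : ℕ) : Type := ℝ × Fib m

/-- The coordinate space of `(t, q^i, q^i_t)`. -/
abbrev Jet (m : ℕ) : Type := (ℝ × Fib m) × Fib m

/-- A smooth locally trivial fibre bundle `Q → ℝ` with typical fibre the `m`-dimensional smooth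
manifold `M`. -/
structure TimeBundle (m : ℕ)
    (M : Type*) [TopologicalSpace M] [ChartedSpace (Fib m) M] [IsManifold 𝓘(ℝ, Fib m) ∞ M]
    (Q : Type*) [TopologicalSpace Q] [ChartedSpace (Base m) Q] [IsManifold 𝓘(ℝ, Base m) ∞ Q] where
  /-- the projection onto the time axis -/
  proj : Q → ℝ
  locallyTrivial : ∀ t : ℝ, ∃ U : Set ℝ, IsOpen U ∧ t ∈ U ∧
    ∃ Φ : OpenPartialHomeomorph Q (ℝ × M),
      Φ.source = proj ⁻¹' U ∧ Φ.target = U ×ˢ univ ∧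
      (∀ q ∈ Φ.source, (Φ q).1 = proj q) ∧
      ContMDiffOn 𝓘(ℝ, Base m) (𝓘(ℝ, ℝ).prod 𝓘(ℝ, Fib m)) ∞ Φ Φ.source ∧
      ContMDiffOn (𝓘(ℝ, ℝ).prod 𝓘(ℝ, Fib m)) 𝓘(ℝ, Base m) ∞ Φ.symm Φ.target

variable {m : ℕ}
  {M : Type*} [TopologicalSpace M] [ChartedSpace (Fib m) M] [IsManifold 𝓘(ℝ, Fib m) ∞ M]
  {Q : Type*} [TopologicalSpace Q] [ChartedSpace (Base m) Q] [IsManifold 𝓘(ℝ, Base m) ∞ Q]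

/-- Bundle coordinates `(t, q^i)` on an open subset of `Q`: smooth coordinates whose first
component is the time. -/
structure BundleChart (B : TimeBundle m M Q) where
  /-- the coordinate map -/
  coord : OpenPartialHomeomorph Q (Base m)
  fst_eq : ∀ q ∈ coord.source, (coord q).1 = B.proj q
  smooth : ContMDiffOn 𝓘(ℝ, Base m) 𝓘(ℝ, Base m) ∞ coord coord.source
  smooth_symm : ContMDiffOn 𝓘(ℝ, Base m) 𝓘(ℝ, Base m) ∞ coord.symm coord.target

/-- The differential of the projection `Q → ℝ`, i.e. the 1-form `dt` on `Q`. -/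
def dtQ (B : TimeBundle m M Q) (q : Q) : TangentSpace 𝓘(ℝ, Base m) q →L[ℝ] ℝ :=
  mfderiv 𝓘(ℝ, Base m) 𝓘(ℝ, ℝ) B.proj q

/-- The first order jet manifold `J¹Q` of sections of `Q → ℝ`, identified with its canonical image
in `TQ`: the jet of a section `s` at `t` is its velocity `s'(t)`, and these velocities are the
tangent vectors `v` with `dt(v) = 1`. -/
@[ext]
structure J1 (B : TimeBundle m M Q) where
  /-- the underlying tangent vector, i.e. the canonical imbedding `J¹Q → TQ` -/
  val : TangentBundle 𝓘(ℝ, Base m) Q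
  property : dtQ B val.1 val.2 = 1

variable {B : TimeBundle m M Q}

/-- The topology of a subspace of `TQ`. -/
instance : TopologicalSpace (J1 B) := TopologicalSpace.induced J1.val inferInstance

lemma continuous_val : Continuous (J1.val : J1 B → TangentBundle 𝓘(ℝ, Base m) Q) :=
  continuous_induced_dom

/-- The projection `J¹Q → Q`. -/
def jetProj (B : TimeBundle m M Q) (z : J1 B) : Q := z.val.1

/-- The projection `J¹Q → ℝ`. -/
def jetTime (B : TimeBundle m M Q) (z : J1 B) : ℝ := B.proj (jetProj B z)

/-- The point `z` of `J¹Q`, regarded as a tangent vector to `Q`. -/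
def vel (z : J1 B) : TangentSpace 𝓘(ℝ, Base m) (jetProj B z) := z.val.2

lemma dtQ_vel (z : J1 B) : dtQ B (jetProj B z) (vel z) = 1 := z.property

section Coordinates

lemma exists_bundleChart (B : TimeBundle m M Q) (q : Q) :
    ∃ φ : BundleChart B, q ∈ φ.coord.source := by
  obtain ⟨U, hU, ht, Φ, hs, htar, hfst, hsm, hsm'⟩ := B.locallyTrivial (B.proj q)
  let c : OpenPartialHomeomorph (ℝ × M) (ℝ × Fib m) :=
    (OpenPartialHomeomorph.refl ℝ).prod (chartAt (Fib m) (Φ q).2)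
  have hc : ContMDiffOn (𝓘(ℝ, ℝ).prod 𝓘(ℝ, Fib m)) 𝓘(ℝ, Base m) ∞ c c.source := by
    rw [modelWithCornersSelf_prod, ← chartedSpaceSelf_prod]
    exact contMDiffOn_id.prodMap (contMDiffOn_chart (I := 𝓘(ℝ, Fib m)))
  have hc' : ContMDiffOn 𝓘(ℝ, Base m) (𝓘(ℝ, ℝ).prod 𝓘(ℝ, Fib m)) ∞ c.symm c.target := by
    rw [modelWithCornersSelf_prod, ← chartedSpaceSelf_prod]
    exact contMDiffOn_id.prodMap (contMDiffOn_chart_symm (I := 𝓘(ℝ, Fib m)))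
  refine ⟨⟨Φ.trans c, ?_, ?_, ?_⟩, ?_⟩
  · intro x hx
    exact hfst x hx.1
  · exact hc.comp (hsm.mono fun x hx => hx.1) (fun x hx => hx.2)
  · have hsub : (Φ.trans c).target ⊆ c.target := fun x hx => hx.1
    exact hsm'.comp (hc'.mono hsub) (fun x hx => hx.2)
  · have : q ∈ Φ.source := by rw [hs]; exact ht
    refine ⟨this, ?_⟩
    simp [c]

lemma BundleChart.mdiff (φ : BundleChart B) {q : Q} (hq : q ∈ φ.coord.source) :
    MDifferentiableAt 𝓘(ℝ, Base m) 𝓘(ℝ, Base m) φ.coord q :=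
  (φ.smooth.contMDiffAt (φ.coord.open_source.mem_nhds hq)).mdifferentiableAt (by simp)

lemma BundleChart.mdiff_symm (φ : BundleChart B) {x : Base m} (hx : x ∈ φ.coord.target) :
    MDifferentiableAt 𝓘(ℝ, Base m) 𝓘(ℝ, Base m) φ.coord.symm x :=
  (φ.smooth_symm.contMDiffAt (φ.coord.open_target.mem_nhds hx)).mdifferentiableAt (by simp)

lemma contMDiff_proj (B : TimeBundle m M Q) :
    ContMDiff 𝓘(ℝ, Base m) 𝓘(ℝ, ℝ) ∞ B.proj := by
  intro q
  obtain ⟨φ, hq⟩ := exists_bundleChart B q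
  have h := φ.smooth.contMDiffAt (φ.coord.open_source.mem_nhds hq)
  have h2 : ContMDiffAt 𝓘(ℝ, Base m) 𝓘(ℝ, ℝ) ∞ (fun p => (φ.coord p).1) q :=
    contDiff_fst.contMDiff.contMDiffAt.comp q h
  refine h2.congr_of_eventuallyEq ?_
  filter_upwards [φ.coord.open_source.mem_nhds hq] with p hp
  exact (φ.fst_eq p hp).symm

/-- The differential of a bundle chart. -/
def BundleChart.d (φ : BundleChart B) (q : Q) : TangentSpace 𝓘(ℝ, Base m) q →L[ℝ] Base m :=
  mfderiv 𝓘(ℝ, Base m) 𝓘(ℝ, Base m) φ.coord q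

/-- The differential of the inverse of a bundle chart. -/
def BundleChart.dsymm (φ : BundleChart B) (x : Base m) :
    Base m →L[ℝ] TangentSpace 𝓘(ℝ, Base m) (φ.coord.symm x) :=
  mfderiv 𝓘(ℝ, Base m) 𝓘(ℝ, Base m) φ.coord.symm x

lemma BundleChart.d_dsymm (φ : BundleChart B) {x : Base m} (hx : x ∈ φ.coord.target)
    (w : Base m) : φ.d (φ.coord.symm x) (φ.dsymm x w) = w := by
  have h := mfderiv_comp x (φ.mdiff (φ.coord.map_target hx)) (φ.mdiff_symm hx)
  have h2 : mfderiv 𝓘(ℝ, Base m) 𝓘(ℝ, Base m) (φ.coord ∘ φ.coord.symm) x =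
      ContinuousLinearMap.id ℝ _ := by
    rw [← mfderiv_id]
    refine Filter.EventuallyEq.mfderiv_eq ?_
    filter_upwards [φ.coord.open_target.mem_nhds hx] with y hy
    exact φ.coord.right_inv hy
  rw [h2] at h
  exact (DFunLike.congr_fun h w).symm

lemma BundleChart.dsymm_d (φ : BundleChart B) {q : Q} (hq : q ∈ φ.coord.source)
    (v : TangentSpace 𝓘(ℝ, Base m) q) : φ.dsymm (φ.coord q) (φ.d q v) = v := by
  have h := mfderiv_comp q (φ.mdiff_symm (φ.coord.map_source hq)) (φ.mdiff hq)
  have h2 : mfderiv 𝓘(ℝ, Base m) 𝓘(ℝ, Base m) (φ.coord.symm ∘ φ.coord) q =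
      ContinuousLinearMap.id ℝ _ := by
    rw [← mfderiv_id]
    refine Filter.EventuallyEq.mfderiv_eq ?_
    filter_upwards [φ.coord.open_source.mem_nhds hq] with y hy
    exact φ.coord.left_inv hy
  rw [h2] at h
  exact (DFunLike.congr_fun h v).symm

lemma BundleChart.d_fst (φ : BundleChart B) {q : Q} (hq : q ∈ φ.coord.source)
    (v : TangentSpace 𝓘(ℝ, Base m) q) : (φ.d q v).1 = dtQ B q v := by
  have h1 : MDifferentiableAt 𝓘(ℝ, Base m) 𝓘(ℝ, ℝ) (Prod.fst : Base m → ℝ) (φ.coord q) :=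
    differentiableAt_fst.mdifferentiableAt
  have h := mfderiv_comp q h1 (φ.mdiff hq)
  have h2 : mfderiv 𝓘(ℝ, Base m) 𝓘(ℝ, ℝ) (Prod.fst ∘ φ.coord) q =
      mfderiv 𝓘(ℝ, Base m) 𝓘(ℝ, ℝ) B.proj q := by
    refine Filter.EventuallyEq.mfderiv_eq ?_
    filter_upwards [φ.coord.open_source.mem_nhds hq] with y hy
    exact φ.fst_eq y hy
  rw [h2, mfderiv_eq_fderiv, fderiv_fst] at h
  exact (DFunLike.congr_fun h v).symm

lemma BundleChart.dtQ_dsymm (φ : BundleChart B) {x : Base m} (hx : x ∈ φ.coord.target)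
    (w : Base m) : dtQ B (φ.coord.symm x) (φ.dsymm x w) = w.1 := by
  rw [← φ.d_fst (φ.coord.map_target hx), φ.d_dsymm hx]

lemma BundleChart.nonempty_J1 (φ : BundleChart B) : Nonempty (J1 B) := by
  obtain ⟨ψ, hψ⟩ := exists_bundleChart B (φ.coord.symm 0)
  exact ⟨⟨⟨_, ψ.dsymm (ψ.coord (φ.coord.symm 0)) (1, 0)⟩,
    ψ.dtQ_dsymm (ψ.coord.map_source hψ) (1, 0)⟩⟩

open Classical in
/-- The point of `J¹Q` with coordinates `(t, q^i, q^i_t)`. -/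
def BundleChart.ofCoord (φ : BundleChart B) (x : Jet m) : J1 B :=
  if h : dtQ B (φ.coord.symm x.1) (φ.dsymm x.1 (1, x.2)) = 1 then
    ⟨⟨φ.coord.symm x.1, φ.dsymm x.1 (1, x.2)⟩, h⟩ else φ.nonempty_J1.some

lemma BundleChart.ofCoord_val (φ : BundleChart B) {x : Jet m} (hx : x.1 ∈ φ.coord.target) :
    (φ.ofCoord x).1 = ⟨φ.coord.symm x.1, φ.dsymm x.1 (1, x.2)⟩ := by
  have h : dtQ B (φ.coord.symm x.1) (φ.dsymm x.1 (1, x.2)) = 1 := φ.dtQ_dsymm hx _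
  exact congrArg J1.val (dif_pos h)

/-- The coordinates `(t, q^i, q^i_t)` on `J¹Q` adapted to bundle coordinates `(t, q^i)` on `Q`. -/
def BundleChart.jetChart (φ : BundleChart B) : OpenPartialHomeomorph (J1 B) (Jet m) where
  toFun z := (φ.coord (jetProj B z), (φ.d (jetProj B z) (vel z)).2)
  invFun := φ.ofCoord
  source := jetProj B ⁻¹' φ.coord.source
  target := φ.coord.target ×ˢ univ
  map_source' z hz := ⟨φ.coord.map_source hz, mem_univ _⟩
  map_target' x hx := by
    change (φ.ofCoord x).1.1 ∈ φ.coord.source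
    rw [φ.ofCoord_val hx.1]
    exact φ.coord.map_target hx.1
  left_inv' z hz := by
    have hz : z.1.1 ∈ φ.coord.source := hz
    apply J1.ext
    rw [φ.ofCoord_val (φ.coord.map_source hz)]
    have h1 : ((1 : ℝ), (φ.d (jetProj B z) (vel z)).2) = φ.d (jetProj B z) (vel z) :=
      Prod.ext ((φ.d_fst hz (vel z)).trans (dtQ_vel z)).symm rfl
    refine Bundle.TotalSpace.ext (φ.coord.left_inv hz) ?_
    refine heq_of_eq ?_
    change φ.dsymm (φ.coord (jetProj B z)) ((1 : ℝ), (φ.d (jetProj B z) (vel z)).2) = vel z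
    rw [h1]
    exact φ.dsymm_d hz _
  right_inv' x hx := by
    have key : ∀ v : TangentBundle 𝓘(ℝ, Base m) Q,
        v = ⟨φ.coord.symm x.1, φ.dsymm x.1 (1, x.2)⟩ →
        ((φ.coord v.1, (φ.d v.1 v.2).2) : Jet m) = x := by
      rintro v rfl
      refine Prod.ext (φ.coord.right_inv hx.1) ?_
      exact congrArg (Prod.snd : Base m → Fib m) (φ.d_dsymm hx.1 (1, x.2))
    exact key _ (φ.ofCoord_val hx.1)
  open_source := by
    have : Continuous (jetProj B) :=
      (FiberBundle.continuous_proj (Base m) (TangentSpace 𝓘(ℝ, Base m))).comp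
        continuous_val
    exact φ.coord.open_source.preimage this
  open_target := φ.coord.open_target.prod isOpen_univ
  continuousOn_toFun := by
    have hp : Continuous (jetProj B) :=
      (FiberBundle.continuous_proj (Base m) (TangentSpace 𝓘(ℝ, Base m))).comp
        continuous_val
    refine (φ.coord.continuousOn.comp hp.continuousOn (fun z hz => hz)).prodMk ?_
    have h1 := φ.smooth.continuousOn_tangentMapWithin (by simp)
      φ.coord.open_source.uniqueMDiffOn
    have h2 : ContinuousOn
        (fun v : TangentBundle 𝓘(ℝ, Base m) Q => (φ.d v.1 v.2).2)
        (TotalSpace.proj ⁻¹' φ.coord.source) := by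
      have h3 := (continuous_snd.comp (contMDiff_snd_tangentBundle_modelSpace (n := 1)
        (Base m) 𝓘(ℝ, Base m)).continuous).comp_continuousOn h1
      refine h3.congr ?_
      intro v hv
      change _ = (mfderivWithin 𝓘(ℝ, Base m) 𝓘(ℝ, Base m) φ.coord φ.coord.source v.1 v.2).2
      rw [mfderivWithin_of_isOpen φ.coord.open_source hv]
      rfl
    exact h2.comp continuous_val.continuousOn (fun z hz => hz)
  continuousOn_invFun := by
    have h1 := φ.smooth_symm.continuousOn_tangentMapWithin (by simp)
      φ.coord.open_target.uniqueMDiffOn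
    have h2 : Continuous (fun x : Jet m =>
        (⟨x.1, ((1 : ℝ), x.2)⟩ : TangentBundle 𝓘(ℝ, Base m) (Base m))) :=
      (tangentBundleModelSpaceHomeomorph 𝓘(ℝ, Base m)).symm.continuous.comp
        (f := fun x : Jet m => ((x.1, ((1 : ℝ), x.2)) : ModelProd (Base m) (Base m)))
        (continuous_fst.prodMk (continuous_const.prodMk continuous_snd))
    have h3 := h1.comp (t := TotalSpace.proj ⁻¹' φ.coord.target) h2.continuousOn
      (s := φ.coord.target ×ˢ univ) (fun x hx => hx.1)
    have h4 : ContinuousOn (J1.val ∘ φ.ofCoord) (φ.coord.target ×ˢ univ) := by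
      refine h3.congr fun x hx => ?_
      change (φ.ofCoord x).val = ⟨φ.coord.symm x.1,
        mfderivWithin 𝓘(ℝ, Base m) 𝓘(ℝ, Base m) φ.coord.symm φ.coord.target x.1 (1, x.2)⟩
      rw [mfderivWithin_of_isOpen φ.coord.open_target hx.1]
      exact φ.ofCoord_val hx.1
    exact (Topology.IsInducing.induced J1.val).continuousOn_iff.2 h4

lemma BundleChart.jetChart_symm_val (φ : BundleChart B) {x : Jet m}
    (hx : x.1 ∈ φ.coord.target) :
    (φ.jetChart.symm x).val = ⟨φ.coord.symm x.1, φ.dsymm x.1 (1, x.2)⟩ :=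
  φ.ofCoord_val hx

lemma BundleChart.contDiffOn_trans (φ φ' : BundleChart B) :
    ContDiffOn ℝ ∞ (φ'.jetChart ∘ φ.jetChart.symm) (φ.jetChart.symm.trans φ'.jetChart).source := by
  set S : Set (Base m) := (φ.coord.symm.trans φ'.coord).source with hS
  have hSo : IsOpen S := (φ.coord.symm.trans φ'.coord).open_source
  set τ : Base m → Base m := φ'.coord ∘ φ.coord.symm with hτ
  have hτs : ContDiffOn ℝ ∞ τ S := by
    rw [← contMDiffOn_iff_contDiffOn]
    exact φ'.smooth.comp (φ.smooth_symm.mono fun x hx => hx.1) (fun x hx => hx.2)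
  have hsub : ∀ x ∈ (φ.jetChart.symm.trans φ'.jetChart).source, x.1 ∈ S := by
    intro x hx
    refine ⟨hx.1.1, ?_⟩
    have h2 : (φ.jetChart.symm x).val.1 ∈ φ'.coord.source := hx.2
    rw [φ.jetChart_symm_val hx.1.1] at h2
    exact h2
  have hd : ContDiffOn ℝ ∞ (fun x : Jet m => (τ x.1, (fderiv ℝ τ x.1 (1, x.2)).2))
      (φ.jetChart.symm.trans φ'.jetChart).source := by
    have h1 : ContDiffOn ℝ ∞ (fun x : Jet m => fderiv ℝ τ x.1)
        (φ.jetChart.symm.trans φ'.jetChart).source :=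
      (hτs.fderiv_of_isOpen hSo (m := ∞) (by simp)).comp contDiff_fst.contDiffOn hsub
    have h2 : ContDiffOn ℝ ∞ (fun x : Jet m => τ x.1)
        (φ.jetChart.symm.trans φ'.jetChart).source :=
      hτs.comp contDiff_fst.contDiffOn hsub
    exact h2.prodMk (contDiff_snd.comp_contDiffOn
      (h1.clm_apply (contDiff_const.prodMk contDiff_snd).contDiffOn))
  refine hd.congr fun x hx => ?_
  have hxS := hsub x hx
  have key : ∀ v : TangentBundle 𝓘(ℝ, Base m) Q,
      v = ⟨φ.coord.symm x.1, φ.dsymm x.1 (1, x.2)⟩ →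
      ((φ'.coord v.1, (φ'.d v.1 v.2).2) : Jet m) = (τ x.1, (fderiv ℝ τ x.1 (1, x.2)).2) := by
    rintro v rfl
    refine Prod.ext rfl ?_
    have h := mfderiv_comp x.1 (φ'.mdiff hxS.2) (φ.mdiff_symm hxS.1)
    rw [mfderiv_eq_fderiv] at h
    exact congrArg (Prod.snd : Base m → Fib m) (DFunLike.congr_fun h (1, x.2)).symm
  exact key _ (φ.jetChart_symm_val hx.1.1)

end Coordinates

/-- The smooth atlas of `J¹Q` made of all charts `(t, q^i, q^i_t)`. -/
instance : ChartedSpace (Jet m) (J1 B) where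
  atlas := {e | ∃ φ : BundleChart B, e = φ.jetChart}
  chartAt z := (exists_bundleChart B (jetProj B z)).choose.jetChart
  mem_chart_source z := (exists_bundleChart B (jetProj B z)).choose_spec
  chart_mem_atlas _ := ⟨_, rfl⟩

instance : IsManifold 𝓘(ℝ, Jet m) ∞ (J1 B) := by
  refine isManifold_of_contDiffOn _ _ _ ?_
  rintro e e' ⟨φ, rfl⟩ ⟨φ', rfl⟩
  simpa using φ.contDiffOn_trans φ'

lemma BundleChart.jetChart_mem (φ : BundleChart B) : φ.jetChart ∈ atlas (Jet m) (J1 B) :=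
  ⟨φ, rfl⟩

lemma BundleChart.contMDiffOn_jetChart (φ : BundleChart B) :
    ContMDiffOn 𝓘(ℝ, Jet m) 𝓘(ℝ, Jet m) ∞ φ.jetChart φ.jetChart.source :=
  contMDiffOn_of_mem_maximalAtlas (IsManifold.subset_maximalAtlas φ.jetChart_mem)

lemma BundleChart.contMDiffOn_jetChart_symm (φ : BundleChart B) :
    ContMDiffOn 𝓘(ℝ, Jet m) 𝓘(ℝ, Jet m) ∞ φ.jetChart.symm φ.jetChart.target :=
  contMDiffOn_symm_of_mem_maximalAtlas (IsManifold.subset_maximalAtlas φ.jetChart_mem)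

lemma contMDiff_jetProj (B : TimeBundle m M Q) :
    ContMDiff 𝓘(ℝ, Jet m) 𝓘(ℝ, Base m) ∞ (jetProj B) := by
  intro z
  obtain ⟨φ, hq⟩ := exists_bundleChart B (jetProj B z)
  have h := φ.contMDiffOn_jetChart.contMDiffAt (φ.jetChart.open_source.mem_nhds hq)
  have h2 : ContMDiffAt 𝓘(ℝ, Jet m) 𝓘(ℝ, Base m) ∞ (fun y => (φ.jetChart y).1) z :=
    contDiff_fst.contMDiff.contMDiffAt.comp z h
  have h3 := (φ.smooth_symm.contMDiffAt
    (φ.coord.open_target.mem_nhds (φ.coord.map_source hq))).comp z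
    (f := fun y => (φ.jetChart y).1) h2
  refine h3.congr_of_eventuallyEq ?_
  filter_upwards [φ.jetChart.open_source.mem_nhds hq] with p hp
  exact (φ.coord.left_inv hp).symm

/-- The tangent space of `J¹Q`. -/
abbrev TJ (z : J1 B) : Type := TangentSpace 𝓘(ℝ, Jet m) z

/-- The tangent map of `J¹Q → Q`. -/
def dProj (z : J1 B) : TJ z →L[ℝ] TangentSpace 𝓘(ℝ, Base m) (jetProj B z) :=
  mfderiv 𝓘(ℝ, Jet m) 𝓘(ℝ, Base m) (jetProj B) z

/-- The tangent map of `J¹Q → ℝ`, i.e. the 1-form `dt` on `J¹Q`. -/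
def dtJ (z : J1 B) : TJ z →L[ℝ] ℝ :=
  mfderiv 𝓘(ℝ, Jet m) 𝓘(ℝ, ℝ) (jetTime B) z

lemma contMDiff_jetTime (B : TimeBundle m M Q) :
    ContMDiff 𝓘(ℝ, Jet m) 𝓘(ℝ, ℝ) ∞ (jetTime B) :=
  (contMDiff_proj B).comp (contMDiff_jetProj B)

lemma dtJ_eq (z : J1 B) (w : TJ z) : dtJ z w = dtQ B (jetProj B z) (dProj z w) :=
  DFunLike.congr_fun (mfderiv_comp z ((contMDiff_proj B).mdifferentiableAt (by simp))
    ((contMDiff_jetProj B).mdifferentiableAt (by simp))) w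

section Connections

/-- A (smooth, in general nonlinear) connection on a fibred manifold `f : Y → X`, i.e. a smooth
section of the jet bundle `J¹Y → Y` of `f`, given by its horizontal lift
`T_{f y} X → T_y Y`, a right inverse of the tangent map of `f`. Smoothness is that of the
corresponding horizontal projection `TY → TY`. -/
@[ext]
structure Connection {E H E' H' : Type*}
    [NormedAddCommGroup E] [NormedSpace ℝ E] [TopologicalSpace H] (I : ModelWithCorners ℝ E H)
    [NormedAddCommGroup E'] [NormedSpace ℝ E'] [TopologicalSpace H'] (I' : ModelWithCorners ℝ E' H')
    {Y X : Type*} [TopologicalSpace Y] [ChartedSpace H Y] [IsManifold I ∞ Y]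
    [TopologicalSpace X] [ChartedSpace H' X] [IsManifold I' ∞ X] (f : Y → X) where
  /-- the horizontal lift -/
  lift : ∀ y : Y, TangentSpace I' (f y) →L[ℝ] TangentSpace I y
  mfderiv_lift : ∀ (y : Y) (v : TangentSpace I' (f y)), mfderiv I I' f y (lift y v) = v
  smooth : ContMDiff I.tangent I.tangent ∞
    (fun w : TangentBundle I Y => (⟨w.1, lift w.1 (mfderiv I I' f w.1 w.2)⟩ : TangentBundle I Y))

/-- A dynamic connection: a connection on the affine jet bundle `J¹Q → Q`. -/
abbrev DynamicConnection (B : TimeBundle m M Q) :=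
  Connection 𝓘(ℝ, Jet m) 𝓘(ℝ, Base m) (jetProj B)

/-- A connection on the jet bundle `J¹Q → ℝ`. -/
abbrev TimeConnection (B : TimeBundle m M Q) :=
  Connection 𝓘(ℝ, Jet m) 𝓘(ℝ, ℝ) (jetTime B)

/-- The vector field on `J¹Q` which represents a connection on `J¹Q → ℝ`: the horizontal lift of
the standard vector field `∂_t` on `ℝ`. -/
def TimeConnection.field (ξ : TimeConnection B) (z : J1 B) : TJ z := ξ.lift z (1 : ℝ)

/-- A connection on `J¹Q → ℝ` is holonomic if it takes its values in `J²Q`, which is the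
subbundle of `J¹J¹Q` where the two projections `J¹J¹Q → J¹Q` agree (in coordinates
`q^i_(t) = q^i_t`): the tangent map of `J¹Q → Q` sends the vector `ξ(z)` to `z`. -/
def TimeConnection.IsHolonomic (ξ : TimeConnection B) : Prop :=
  ∀ z : J1 B, dProj z (ξ.field z) = vel z

/-- A holonomic connection on `J¹Q → ℝ`. -/
abbrev HolonomicConnection (B : TimeBundle m M Q) :=
  {ξ : TimeConnection B // ξ.IsHolonomic}

/-- The vector field of a holonomic connection. -/
def HolonomicConnection.field (ξ : HolonomicConnection B) (z : J1 B) : TJ z := ξ.1.field z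

lemma HolonomicConnection.dtJ_field (ξ : HolonomicConnection B) (z : J1 B) :
    dtJ z (ξ.field z) = 1 := ξ.1.mfderiv_lift z (1 : ℝ)

lemma BundleChart.dProj_symm (φ : BundleChart B) {x : Jet m} (hx : x ∈ φ.jetChart.target)
    (a : Jet m) :
    (dProj (φ.jetChart.symm x) (mfderiv 𝓘(ℝ, Jet m) 𝓘(ℝ, Jet m) φ.jetChart.symm x a) : Base m) =
      (φ.dsymm x.1 a.1 : Base m) := by
  have hψ : MDifferentiableAt 𝓘(ℝ, Jet m) 𝓘(ℝ, Jet m) φ.jetChart.symm x :=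
    (φ.contMDiffOn_jetChart_symm.contMDiffAt
      (φ.jetChart.open_target.mem_nhds hx)).mdifferentiableAt (by simp)
  have h1 := mfderiv_comp x
    ((contMDiff_jetProj B).mdifferentiableAt (x := φ.jetChart.symm x) (by simp)) hψ
  have hfst : MDifferentiableAt 𝓘(ℝ, Jet m) 𝓘(ℝ, Base m) (Prod.fst : Jet m → Base m) x :=
    differentiableAt_fst.mdifferentiableAt
  have h2 := mfderiv_comp x (φ.mdiff_symm hx.1) hfst
  have h3 : mfderiv 𝓘(ℝ, Jet m) 𝓘(ℝ, Base m) (jetProj B ∘ φ.jetChart.symm) x =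
      mfderiv 𝓘(ℝ, Jet m) 𝓘(ℝ, Base m) (φ.coord.symm ∘ Prod.fst) x := by
    refine Filter.EventuallyEq.mfderiv_eq ?_
    filter_upwards [φ.jetChart.open_target.mem_nhds hx] with y hy
    exact congrArg TotalSpace.proj (φ.jetChart_symm_val hy.1)
  rw [mfderiv_eq_fderiv, fderiv_fst] at h2
  have h1' : (mfderiv 𝓘(ℝ, Jet m) 𝓘(ℝ, Base m) (jetProj B ∘ φ.jetChart.symm) x a : Base m) =
    (dProj (φ.jetChart.symm x)
      (mfderiv 𝓘(ℝ, Jet m) 𝓘(ℝ, Jet m) φ.jetChart.symm x a) : Base m) := DFunLike.congr_fun h1 a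
  have h2' : (mfderiv 𝓘(ℝ, Jet m) 𝓘(ℝ, Base m) (φ.coord.symm ∘ Prod.fst) x a : Base m) =
    (φ.dsymm x.1 a.1 : Base m) := DFunLike.congr_fun h2 a
  have h3' : (mfderiv 𝓘(ℝ, Jet m) 𝓘(ℝ, Base m) (jetProj B ∘ φ.jetChart.symm) x a : Base m) =
    (mfderiv 𝓘(ℝ, Jet m) 𝓘(ℝ, Base m) (φ.coord.symm ∘ Prod.fst) x a : Base m) :=
    DFunLike.congr_fun h3 a
  exact h1'.symm.trans (h3'.trans h2')

lemma DynamicConnection.contMDiff_lift_vel (γ : DynamicConnection B) :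
    ContMDiff (𝓘(ℝ, Jet m).tangent) (𝓘(ℝ, Jet m).tangent) ∞
      (fun w : TangentBundle 𝓘(ℝ, Jet m) (J1 B) =>
        (⟨w.1, dtJ w.1 w.2 • γ.lift w.1 (vel w.1)⟩ : TangentBundle 𝓘(ℝ, Jet m) (J1 B))) := by
  intro w₀
  obtain ⟨φ, hq⟩ := exists_bundleChart B (jetProj B w₀.1)
  let N : Set (TangentBundle 𝓘(ℝ, Jet m) (J1 B)) := TotalSpace.proj ⁻¹' φ.jetChart.source
  have hN : IsOpen N := φ.jetChart.open_source.preimage (FiberBundle.continuous_proj _ _)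
  have hwN : w₀ ∈ N := hq
  refine ContMDiffOn.contMDiffAt (s := N) ?_ (hN.mem_nhds hwN)
  have hdt : ContMDiff 𝓘(ℝ, Jet m).tangent 𝓘(ℝ, ℝ) ∞
      (fun w : TangentBundle 𝓘(ℝ, Jet m) (J1 B) => dtJ w.1 w.2) :=
    (contMDiff_snd_tangentBundle_modelSpace ℝ 𝓘(ℝ, ℝ)).comp
      ((contMDiff_jetTime B).contMDiff_tangentMap (by simp))
  have hx : ContMDiffOn 𝓘(ℝ, Jet m).tangent 𝓘(ℝ, Jet m) ∞
      (fun w : TangentBundle 𝓘(ℝ, Jet m) (J1 B) => φ.jetChart w.1) N :=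
    φ.contMDiffOn_jetChart.comp (Bundle.contMDiff_proj _).contMDiffOn (fun w hw => hw)
  have hv : ContMDiffOn 𝓘(ℝ, Jet m).tangent 𝓘(ℝ, Jet m) ∞
      (fun w : TangentBundle 𝓘(ℝ, Jet m) (J1 B) =>
        dtJ w.1 w.2 • (((1 : ℝ), (φ.jetChart w.1).2), (0 : Fib m))) N := by
    refine hdt.contMDiffOn.smul ?_
    have hc : ContDiff ℝ ∞ (fun x : Jet m => ((((1 : ℝ), x.2), (0 : Fib m)) : Jet m)) := by
      fun_prop
    exact hc.contMDiff.comp_contMDiffOn hx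
  have hsec : ContMDiffOn 𝓘(ℝ, Jet m).tangent 𝓘(ℝ, Jet m).tangent ∞
      (fun w : TangentBundle 𝓘(ℝ, Jet m) (J1 B) => (⟨φ.jetChart w.1,
        dtJ w.1 w.2 • (((1 : ℝ), (φ.jetChart w.1).2), (0 : Fib m))⟩ :
          TangentBundle 𝓘(ℝ, Jet m) (Jet m))) N := by
    intro w hw
    apply Bundle.contMDiffWithinAt_totalSpace.2
    refine ⟨hx w hw, ?_⟩
    convert! hv w hw using 1
    simp
  have hT := φ.contMDiffOn_jetChart_symm.contMDiffOn_tangentMapWithin (m := ∞) (by simp)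
    φ.jetChart.open_target.uniqueMDiffOn
  have hP := γ.smooth.comp_contMDiffOn
    (hT.comp hsec (fun w hw => φ.jetChart.map_source hw))
  refine hP.congr fun w hw => ?_
  have hz : φ.jetChart.symm (φ.jetChart w.1) = w.1 := φ.jetChart.left_inv hw
  have hxt : φ.jetChart w.1 ∈ φ.jetChart.target := φ.jetChart.map_source hw
  have hF := congrArg (fun z : J1 B =>
    (⟨z, dtJ w.1 w.2 • γ.lift z (vel z)⟩ : TangentBundle 𝓘(ℝ, Jet m) (J1 B))) hz
  refine hF.symm.trans ?_
  set c : ℝ := dtJ w.1 w.2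
  set x : Jet m := φ.jetChart w.1
  have hvel : (vel (φ.jetChart.symm x) : Base m) = (φ.dsymm x.1 (1, x.2) : Base m) :=
    congrArg (fun v : TangentBundle 𝓘(ℝ, Base m) Q => (v.2 : Base m)) (φ.jetChart_symm_val hxt.1)
  have hd := φ.dProj_symm hxt (c • (((1 : ℝ), x.2), (0 : Fib m)))
  have hd2 : dProj (φ.jetChart.symm x) (mfderivWithin 𝓘(ℝ, Jet m) 𝓘(ℝ, Jet m) φ.jetChart.symm
      φ.jetChart.target x (c • (((1 : ℝ), x.2), (0 : Fib m)))) =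
      c • vel (φ.jetChart.symm x) := by
    rw [mfderivWithin_of_isOpen φ.jetChart.open_target hxt]
    refine hd.trans ?_
    have h5 : (φ.dsymm x.1 (c • ((1 : ℝ), x.2)) : Base m) =
      c • (φ.dsymm x.1 (1, x.2) : Base m) := map_smul (φ.dsymm x.1) c ((1 : ℝ), x.2)
    exact h5.trans (congrArg (fun v : Base m => c • v) hvel.symm)
  have hd3 := congrArg (γ.lift (φ.jetChart.symm x)) hd2
  rw [map_smul] at hd3
  exact congrArg (TotalSpace.mk (F := Jet m) (E := TangentSpace 𝓘(ℝ, Jet m))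
    (φ.jetChart.symm x)) hd3.symm

/-- The holonomic connection `ξ_γ` defined by a dynamic connection `γ`: the vector `ξ_γ(z)` is the
`γ`-horizontal lift to `z` of the tangent vector `z` of `Q`. -/
def DynamicConnection.toHolonomic (γ : DynamicConnection B) : HolonomicConnection B :=
  ⟨{ lift := fun z => ContinuousLinearMap.toSpanSingleton ℝ (γ.lift z (vel z))
     mfderiv_lift := by
      intro z (v : ℝ)
      have h1 : dtJ z (v • γ.lift z (vel z)) = v := by
        rw [map_smul, dtJ_eq]
        have h2 : dProj z (γ.lift z (vel z)) = vel z := γ.mfderiv_lift z (vel z)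
        rw [h2, dtQ_vel]
        exact mul_one (v : ℝ)
      exact h1
     smooth := γ.contMDiff_lift_vel }, by
    intro z
    have h1 : dProj z ((1 : ℝ) • γ.lift z (vel z)) = vel z := by
      rw [one_smul]
      exact γ.mfderiv_lift z (vel z)
    exact h1⟩

end Connections

section VerticalEndomorphism

/-- The jet `z + s u`, where `u` is a vertical tangent vector to `Q → ℝ` at the point under `z`
(`J¹Q → Q` is an affine bundle modelled on the vertical tangent bundle `VQ`). -/
def affineLine (z : J1 B) (u : TangentSpace 𝓘(ℝ, Base m) (jetProj B z))
    (hu : dtQ B (jetProj B z) u = 0) (s : ℝ) : J1 B :=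
  ⟨⟨jetProj B z, vel z + s • u⟩, by
    change dtQ B (jetProj B z) (vel z + s • u) = 1
    rw [map_add, map_smul, hu, dtQ_vel, smul_zero, add_zero]⟩

/-- The vertical lift `α⁻¹`: the velocity at `s = 0` of the curve `s ↦ z + s u`. In coordinates it
sends `u = u^i ∂_i` to `u^i ∂_i^t`. -/
def verticalLift (z : J1 B) (u : TangentSpace 𝓘(ℝ, Base m) (jetProj B z))
    (hu : dtQ B (jetProj B z) u = 0) : TJ z :=
  (mfderiv 𝓘(ℝ, ℝ) 𝓘(ℝ, Jet m) (affineLine z u hu) 0 (1 : ℝ) : Jet m)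

/-- The vertical part `Tπ(w) - dt(w) z` of the projection to `TQ` of a tangent vector `w` to `J¹Q`
at `z`. -/
def contactPart (z : J1 B) (w : TJ z) : TangentSpace 𝓘(ℝ, Base m) (jetProj B z) :=
  dProj z w - dtQ B (jetProj B z) (dProj z w) • vel z

lemma dtQ_contactPart (z : J1 B) (w : TJ z) : dtQ B (jetProj B z) (contactPart z w) = 0 := by
  rw [contactPart, map_sub, map_smul, dtQ_vel, smul_eq_mul, mul_one, sub_self]

/-- The vertical endomorphism `v̂` of `TJ¹Q`:
`v̂(∂_t) = -q^i_t ∂_i^t`, `v̂(∂_i) = ∂_i^t`, `v̂(∂_i^t) = 0`. -/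
def vHat (z : J1 B) (w : TJ z) : TJ z :=
  verticalLift z (contactPart z w) (dtQ_contactPart z w)

/-- The fibre at `z` of the vertical tangent bundle `VJ¹Q` of `J¹Q → ℝ`. -/
def VJ (z : J1 B) : Submodule ℝ (TJ z) := LinearMap.ker (dtJ z : TJ z →ₗ[ℝ] ℝ)

/-- A linear endomorphism (over the identity) of the vertical tangent bundle `VJ¹Q`. -/
abbrev VerticalEndo (B : TimeBundle m M Q) := (z : J1 B) → VJ z →ₗ[ℝ] VJ z

/-- `I` is the endomorphism `I_ξ` of `VJ¹Q`, i.e. `I(u) = [ξ, v̂(u)] - v̂([ξ, u])` for all (local)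
vertical vector fields `u` on `J¹Q → ℝ`. -/
def IsBracketEndo (ξ : HolonomicConnection B) (I : VerticalEndo B) : Prop :=
  ∀ (W : Set (J1 B)) (u : (z : J1 B) → TJ z), IsOpen W →
    ContMDiffOn 𝓘(ℝ, Jet m) 𝓘(ℝ, Jet m).tangent ∞
      (fun z => (⟨z, u z⟩ : TangentBundle 𝓘(ℝ, Jet m) (J1 B))) W →
    ∀ hu : ∀ z ∈ W, u z ∈ VJ z, ∀ (z : J1 B) (hz : z ∈ W),
      (I z ⟨u z, hu z hz⟩ : TJ z) =
        VectorField.mlieBracket 𝓘(ℝ, Jet m) ξ.field (fun y => vHat y (u y)) z -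
          vHat z (VectorField.mlieBracket 𝓘(ℝ, Jet m) ξ.field u z)

/-- The projection `ξ̂ : TJ¹Q → VJ¹Q`, `w ↦ w - dt(w) ξ`, defined by a holonomic connection. -/
def HolonomicConnection.vertProj (ξ : HolonomicConnection B) (z : J1 B) (w : TJ z) : VJ z :=
  ⟨w - dtJ z w • ξ.field z, by
    change dtJ z (w - dtJ z w • ξ.field z) = 0
    rw [map_sub, map_smul, ξ.dtJ_field, smul_eq_mul, mul_one, sub_self]⟩

/-- The projection `w ↦ w - γ(Tπ(w))` of `TJ¹Q` onto the vertical tangent bundle `V_Q J¹Q` of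
`J¹Q → Q`, defined by a dynamic connection. -/
def DynamicConnection.vertProj (γ : DynamicConnection B) (z : J1 B) (w : TJ z) : TJ z :=
  w - γ.lift z (dProj z w)

end VerticalEndomorphism

section Components

/-- The differential of the coordinates `(t, q^i, q^i_t)`: the coordinate components of a tangent
vector to `J¹Q`. -/
def BundleChart.dJet (φ : BundleChart B) (z : J1 B) : TJ z →L[ℝ] Jet m :=
  mfderiv 𝓘(ℝ, Jet m) 𝓘(ℝ, Jet m) φ.jetChart z

/-- The coordinate `q^i_t`. -/
def qt (φ : BundleChart B) (i : Fin m) (z : J1 B) : ℝ := (φ.jetChart z).2 i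

/-- The partial derivative `∂_i^t f = ∂f/∂q^i_t` of a function on `J¹Q`. -/
def dqt (φ : BundleChart B) (i : Fin m) (f : J1 B → ℝ) (z : J1 B) : ℝ :=
  fderiv ℝ (f ∘ φ.jetChart.symm) (φ.jetChart z) ((0 : Base m), EuclideanSpace.single i (1 : ℝ))

/-- The component `ξ^i` of a holonomic connection `ξ = ∂_t + q^i_t ∂_i + ξ^i ∂_i^t`. -/
def xiComp (φ : BundleChart B) (ξ : HolonomicConnection B) (i : Fin m) (z : J1 B) : ℝ :=
  (φ.dJet z (ξ.field z)).2 i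

/-- The coordinate vector with components `a` at a point `q` of `Q`. -/
def coordVec (φ : BundleChart B) (q : Q) (a : Base m) : TangentSpace 𝓘(ℝ, Base m) q :=
  (φ.dsymm (φ.coord q) a : Base m)

/-- The component `γ^i_0` of `γ = dt ⊗ (∂_t + γ^i_0 ∂_i^t) + dq^j ⊗ (∂_j + γ^i_j ∂_i^t)`: the
`∂_i^t` component of the lift of `∂_t`. -/
def gammaTime (φ : BundleChart B) (γ : DynamicConnection B) (i : Fin m) (z : J1 B) : ℝ :=
  (φ.dJet z (γ.lift z (coordVec φ (jetProj B z) ((1 : ℝ), (0 : Fib m))))).2 i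

/-- The component `γ^i_j` of `γ = dt ⊗ (∂_t + γ^i_0 ∂_i^t) + dq^j ⊗ (∂_j + γ^i_j ∂_i^t)`: the
`∂_i^t` component of the lift of `∂_j`. -/
def gammaSpace (φ : BundleChart B) (γ : DynamicConnection B) (i j : Fin m) (z : J1 B) : ℝ :=
  (φ.dJet z (γ.lift z (coordVec φ (jetProj B z)
    ((0 : ℝ), EuclideanSpace.single j (1 : ℝ))))).2 i

/-- A dynamic connection is symmetric if `γ^k_i = ∂_i^t γ^k_0 + q^j_t ∂_i^t γ^k_j` in all
bundle coordinates. -/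
def DynamicConnection.IsSymmetric (γ : DynamicConnection B) : Prop :=
  ∀ (φ : BundleChart B) (z : J1 B), jetProj B z ∈ φ.coord.source → ∀ i k : Fin m,
    gammaSpace φ γ k i z =
      dqt φ i (gammaTime φ γ k) z + ∑ j, qt φ j z * dqt φ i (gammaSpace φ γ k j) z

end Components

end TimeMech

end

/-! Everything is a computation in adapted coordinates, and the formula for the bracket endomorphism
carries the invariance. Write a vertical field as `u = a^i ∂_i + b^i ∂^t_i`. Both `[ξ, v̂(u)]` and
`v̂([ξ, u])` contain the derivative term `ξ(a^i) ∂^t_i`. It cancels in the difference, which leaves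
`-a^i ∂_i + (b^i - a^j ∂^t_j ξ^i) ∂^t_i` (`BundleChart.dJet_bracket`). Hence the bracket expression
is tensorial, and since every vertical vector extends to a local vertical field, `I_ξ` exists and is
unique.

`I_ξ` is the identity on `V_Q J¹Q` and acts as `-1` on the quotient, so `½(I_ξ + Id)` projects onto
`V_Q J¹Q`. Composing it with `ξ̂` and subtracting from the identity gives a map whose value at `w`
depends only on the image of `w` in `TQ` (`IsBracketEndo.dJet_sub`). That map is the horizontal lift
of `γ_ξ`. Its coordinate formula holds in every chart because the map was described without
coordinates.

For the symmetry statements put `ξ_γ^k = γ^k_0 + q^j_t γ^k_j`. The product rule gives `∂^t_i ξ_γ^k =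
∂^t_i γ^k_0 + q^j_t ∂^t_i γ^k_j + γ^k_i`, so `γ` is symmetric exactly when `γ^k_i = ½ ∂^t_i ξ_γ^k`
(`DynamicConnection.isSymmetric_iff`). Moreover the correction terms in `γ_ξ` cancel, so `ξ` is
recovered from `γ_ξ`. The last two claims follow. -/

noncomputable section

namespace TimeMech

variable {m : ℕ}
  {M : Type*} [TopologicalSpace M] [ChartedSpace (Fib m) M] [IsManifold 𝓘(ℝ, Fib m) ∞ M]
  {Q : Type*} [TopologicalSpace Q] [ChartedSpace (Base m) Q] [IsManifold 𝓘(ℝ, Base m) ∞ Q]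
  {B : TimeBundle m M Q}

/-! ### Tangent vectors and the vertical endomorphism in jet coordinates -/

section JetCoordinates

/-- The differential of the inverse of a jet chart. -/
def BundleChart.dJetSymm (φ : BundleChart B) (x : Jet m) : Jet m →L[ℝ] TJ (φ.jetChart.symm x) :=
  mfderiv 𝓘(ℝ, Jet m) 𝓘(ℝ, Jet m) φ.jetChart.symm x

lemma BundleChart.mdifferentiable_jetChart (φ : BundleChart B) :
    φ.jetChart.MDifferentiable 𝓘(ℝ, Jet m) 𝓘(ℝ, Jet m) :=
  mdifferentiable_of_mem_atlas φ.jetChart_mem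

/-- The coordinate components of tangent vectors to `J¹Q`, as a linear equivalence. -/
def BundleChart.jetEquiv (φ : BundleChart B) {z : J1 B} (hz : jetProj B z ∈ φ.coord.source) :
    TJ z ≃L[ℝ] Jet m :=
  φ.mdifferentiable_jetChart.mfderiv (x := z) hz

lemma BundleChart.jetEquiv_apply (φ : BundleChart B) {z : J1 B}
    (hz : jetProj B z ∈ φ.coord.source) (w : TJ z) : φ.jetEquiv hz w = φ.dJet z w := rfl

lemma BundleChart.dJet_injective (φ : BundleChart B) {z : J1 B}
    (hz : jetProj B z ∈ φ.coord.source) : Function.Injective (φ.dJet z) :=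
  (φ.jetEquiv hz).injective

lemma BundleChart.jetProj_symm_mem (φ : BundleChart B) {x : Jet m}
    (hx : x ∈ φ.jetChart.target) : jetProj B (φ.jetChart.symm x) ∈ φ.coord.source :=
  φ.jetChart.map_target hx

lemma BundleChart.dJet_dJetSymm (φ : BundleChart B) {x : Jet m} (hx : x ∈ φ.jetChart.target)
    (a : Jet m) : φ.dJet (φ.jetChart.symm x) (φ.dJetSymm x a) = a :=
  DFunLike.congr_fun (φ.mdifferentiable_jetChart.comp_symm_deriv hx) a

lemma BundleChart.dJetSymm_dJet (φ : BundleChart B) {x : Jet m} (hx : x ∈ φ.jetChart.target)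
    (w : TJ (φ.jetChart.symm x)) : φ.dJetSymm x (φ.dJet (φ.jetChart.symm x) w) = w :=
  φ.dJet_injective (φ.jetProj_symm_mem hx) (φ.dJet_dJetSymm hx _)

/-- Properties of points of a jet chart may be checked in coordinates. -/
lemma BundleChart.forall_of_symm (φ : BundleChart B) {p : J1 B → Prop}
    (h : ∀ x ∈ φ.jetChart.target, p (φ.jetChart.symm x)) {z : J1 B}
    (hz : jetProj B z ∈ φ.coord.source) : p z := by
  have := h (φ.jetChart z) (φ.jetChart.map_source hz)
  rwa [φ.jetChart.left_inv hz] at this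

lemma BundleChart.d_dProj (φ : BundleChart B) {z : J1 B}
    (hz : jetProj B z ∈ φ.coord.source) (w : TJ z) :
    φ.d (jetProj B z) (dProj z w) = (φ.dJet z w).1 := by
  have h1 := mfderiv_comp z (φ.mdiff hz)
    ((contMDiff_jetProj B).mdifferentiableAt (x := z) (by simp))
  have h2 : MDifferentiableAt 𝓘(ℝ, Jet m) 𝓘(ℝ, Jet m) φ.jetChart z :=
    φ.mdifferentiable_jetChart.mdifferentiableAt hz
  have hfst : MDifferentiableAt 𝓘(ℝ, Jet m) 𝓘(ℝ, Base m) (Prod.fst : Jet m → Base m)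
      (φ.jetChart z) := differentiableAt_fst.mdifferentiableAt
  have h3 := mfderiv_comp z hfst h2
  rw [mfderiv_eq_fderiv, fderiv_fst] at h3
  have h4 := DFunLike.congr_fun (h1.symm.trans h3) w
  exact h4

lemma BundleChart.dJet_fst_fst (φ : BundleChart B) {z : J1 B}
    (hz : jetProj B z ∈ φ.coord.source) (w : TJ z) : (φ.dJet z w).1.1 = dtJ z w := by
  rw [← φ.d_dProj hz, φ.d_fst hz, dtJ_eq]

lemma BundleChart.d_vel (φ : BundleChart B) {z : J1 B} (hz : jetProj B z ∈ φ.coord.source) :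
    φ.d (jetProj B z) (vel z) = ((1 : ℝ), (φ.jetChart z).2) :=
  Prod.ext ((φ.d_fst hz (vel z)).trans (dtQ_vel z)) rfl

lemma BundleChart.d_coordVec (φ : BundleChart B) {q : Q} (hq : q ∈ φ.coord.source)
    (a : Base m) : φ.d q (coordVec φ q a) = a := by
  have := φ.d_dsymm (φ.coord.map_source hq) a
  rw [φ.coord.left_inv hq] at this
  exact this

lemma BundleChart.d_injective (φ : BundleChart B) {q : Q} (hq : q ∈ φ.coord.source) :
    Function.Injective (φ.d q) := fun v w h => by
  rw [← φ.dsymm_d hq v, h, φ.dsymm_d hq]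

lemma BundleChart.coordVec_d (φ : BundleChart B) {q : Q} (hq : q ∈ φ.coord.source)
    (v : TangentSpace 𝓘(ℝ, Base m) q) : coordVec φ q (φ.d q v) = v :=
  φ.d_injective hq (φ.d_coordVec hq _)

/-- Translation along a fibre of `J¹Q → Q` is a straight line in a jet chart, so the vertical lift
just moves the `∂_i` components of the contact part into the `∂^t_i` slots. -/
lemma BundleChart.dJet_vHat (φ : BundleChart B) {z : J1 B}
    (hz : jetProj B z ∈ φ.coord.source) (w : TJ z) :
    φ.dJet z (vHat z w) =
      ((0 : Base m), (φ.dJet z w).1.2 - (φ.dJet z w).1.1 • (φ.jetChart z).2) := by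
  set u := contactPart z w with hu
  have hu0 : dtQ B (jetProj B z) u = 0 := dtQ_contactPart z w
  have hdu : φ.d (jetProj B z) u =
      ((0 : ℝ), (φ.dJet z w).1.2 - (φ.dJet z w).1.1 • (φ.jetChart z).2) := by
    rw [hu, contactPart, map_sub, map_smul, φ.d_dProj hz, φ.d_vel hz, ← φ.d_fst hz,
      φ.d_dProj hz]
    ext <;> simp
  set e : Fib m := (φ.dJet z w).1.2 - (φ.dJet z w).1.1 • (φ.jetChart z).2
  have hcurve : ∀ s : ℝ, φ.jetChart (affineLine z u hu0 s) =
      φ.jetChart z + s • ((0 : Base m), e) := by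
    intro s
    refine Prod.ext ?_ ?_
    · change φ.coord (jetProj B z) = φ.coord (jetProj B z) + s • (0 : Base m)
      rw [smul_zero, add_zero]
    · change (φ.d (jetProj B z) (vel z + s • u)).2 = (φ.jetChart z).2 + s • e
      rw [map_add, map_smul, hdu, φ.d_vel hz]
      rfl
  have hmem : ∀ s : ℝ, affineLine z u hu0 s ∈ φ.jetChart.source := fun s => hz
  have hder : HasFDerivAt (fun s : ℝ => φ.jetChart z + s • ((0 : Base m), e))
      (ContinuousLinearMap.toSpanSingleton ℝ (((0 : Base m), e) : Jet m)) 0 :=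
    ((ContinuousLinearMap.toSpanSingleton ℝ (((0 : Base m), e) : Jet m)).hasFDerivAt).const_add _
  have hmd : MDifferentiableAt 𝓘(ℝ, ℝ) 𝓘(ℝ, Jet m) (affineLine z u hu0) 0 := by
    -- Without differentiability `mfderiv` would take the default value zero, so it is obtained by
    -- writing the curve as the inverse chart applied to a straight line.
    have h1 : affineLine z u hu0 =
        φ.jetChart.symm ∘ fun s : ℝ => φ.jetChart z + s • ((0 : Base m), e) := by
      funext s
      rw [Function.comp_apply, ← hcurve s, φ.jetChart.left_inv (hmem s)]
    rw [h1]
    refine MDifferentiableAt.comp (I' := 𝓘(ℝ, Jet m)) (0 : ℝ) ?_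
      hder.differentiableAt.mdifferentiableAt
    refine φ.mdifferentiable_jetChart.mdifferentiableAt_symm ?_
    rw [← hcurve 0]
    exact φ.jetChart.map_source (hmem 0)
  have h2 : MDifferentiableAt 𝓘(ℝ, Jet m) 𝓘(ℝ, Jet m) φ.jetChart (affineLine z u hu0 0) :=
    φ.mdifferentiable_jetChart.mdifferentiableAt (hmem 0)
  have h3 := mfderiv_comp (0 : ℝ) h2 hmd
  have h4 : (φ.jetChart ∘ affineLine z u hu0) =
      fun s : ℝ => φ.jetChart z + s • ((0 : Base m), e) := funext hcurve
  rw [h4, mfderiv_eq_fderiv, hder.fderiv] at h3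
  have h5 := DFunLike.congr_fun h3 (1 : ℝ)
  have h6 : affineLine z u hu0 0 = z := by
    apply J1.ext
    change (⟨jetProj B z, vel z + (0 : ℝ) • u⟩ : TangentBundle 𝓘(ℝ, Base m) Q) = z.val
    rw [zero_smul, add_zero]
    rfl
  have h7 : (mfderiv 𝓘(ℝ, Jet m) 𝓘(ℝ, Jet m) φ.jetChart (affineLine z u hu0 0)
      (mfderiv 𝓘(ℝ, ℝ) 𝓘(ℝ, Jet m) (affineLine z u hu0) 0 (1 : ℝ)) : Jet m) =
      (1 : ℝ) • ((0 : Base m), e) := h5.symm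
  rw [one_smul] at h7
  rw [← h7]
  -- The curve at `s = 0` equals `z` only propositionally, so the derivative of the chart has to be
  -- transported between the two base points.
  have h8 : ∀ (y : J1 B) (hy : y = z) (a : Jet m),
      (mfderiv 𝓘(ℝ, Jet m) 𝓘(ℝ, Jet m) φ.jetChart z a : Jet m) =
        (mfderiv 𝓘(ℝ, Jet m) 𝓘(ℝ, Jet m) φ.jetChart y a : Jet m) := by
    rintro y rfl a
    rfl
  exact h8 _ h6 _

end JetCoordinates

/-! ### Smoothness read off from coordinate expressions -/

section Smoothness

/-- The coordinate expression of a vector field on `J¹Q`. -/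
def BundleChart.rep (φ : BundleChart B) (V : (z : J1 B) → TJ z) (x : Jet m) : Jet m :=
  φ.dJet (φ.jetChart.symm x) (V (φ.jetChart.symm x))

lemma BundleChart.contMDiffOn_dJet (φ : BundleChart B) :
    ContMDiffOn 𝓘(ℝ, Jet m).tangent 𝓘(ℝ, Jet m) ∞
      (fun w : TangentBundle 𝓘(ℝ, Jet m) (J1 B) => φ.dJet w.1 w.2)
      (TotalSpace.proj ⁻¹' φ.jetChart.source) := by
  have h1 := φ.contMDiffOn_jetChart.contMDiffOn_tangentMapWithin (m := ∞) (by simp)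
    φ.jetChart.open_source.uniqueMDiffOn
  have h2 := (contMDiff_snd_tangentBundle_modelSpace (n := ∞)
    (Jet m) 𝓘(ℝ, Jet m)).comp_contMDiffOn h1
  refine h2.congr fun v hv => ?_
  change _ = (mfderivWithin 𝓘(ℝ, Jet m) 𝓘(ℝ, Jet m) φ.jetChart φ.jetChart.source v.1 v.2)
  rw [mfderivWithin_of_isOpen φ.jetChart.open_source hv]
  rfl

/-- The source `N` is left arbitrary because the lemma serves for vector fields (`N = J¹Q`),
fibrewise maps (`N = TJ¹Q`) and coordinate domains. -/
lemma BundleChart.contMDiffOn_dJetSymm (φ : BundleChart B) {E H N : Type*}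
    [NormedAddCommGroup E] [NormedSpace ℝ E] [TopologicalSpace H] {I : ModelWithCorners ℝ E H}
    [TopologicalSpace N] [ChartedSpace H N] {s : Set N} {f g : N → Jet m}
    (hf : ContMDiffOn I 𝓘(ℝ, Jet m) ∞ f s) (hg : ContMDiffOn I 𝓘(ℝ, Jet m) ∞ g s)
    (hs : MapsTo f s φ.jetChart.target) :
    ContMDiffOn I 𝓘(ℝ, Jet m).tangent ∞
      (fun y => (⟨φ.jetChart.symm (f y), φ.dJetSymm (f y) (g y)⟩ :
        TangentBundle 𝓘(ℝ, Jet m) (J1 B))) s := by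
  have hsec : ContMDiffOn I 𝓘(ℝ, Jet m).tangent ∞
      (fun y => (⟨f y, g y⟩ : TangentBundle 𝓘(ℝ, Jet m) (Jet m))) s := by
    intro w hw
    apply Bundle.contMDiffWithinAt_totalSpace.2
    refine ⟨hf w hw, ?_⟩
    convert! hg w hw using 1
    simp
  have hT := φ.contMDiffOn_jetChart_symm.contMDiffOn_tangentMapWithin (m := ∞) (by simp)
    φ.jetChart.open_target.uniqueMDiffOn
  refine (hT.comp hsec (fun w hw => hs hw)).congr fun w hw => ?_
  change _ = (⟨φ.jetChart.symm (f w), mfderivWithin 𝓘(ℝ, Jet m) 𝓘(ℝ, Jet m) φ.jetChart.symm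
    φ.jetChart.target (f w) (g w)⟩ : TangentBundle 𝓘(ℝ, Jet m) (J1 B))
  rw [mfderivWithin_of_isOpen φ.jetChart.open_target (hs hw)]
  rfl

lemma BundleChart.contDiffOn_rep (φ : BundleChart B) {V : (z : J1 B) → TJ z} {W : Set (J1 B)}
    (hV : ContMDiffOn 𝓘(ℝ, Jet m) 𝓘(ℝ, Jet m).tangent ∞
      (fun z => (⟨z, V z⟩ : TangentBundle 𝓘(ℝ, Jet m) (J1 B))) W) :
    ContDiffOn ℝ ∞ (φ.rep V) (φ.jetChart.target ∩ φ.jetChart.symm ⁻¹' W) := by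
  rw [← contMDiffOn_iff_contDiffOn]
  exact φ.contMDiffOn_dJet.comp
    (hV.comp (φ.contMDiffOn_jetChart_symm.mono inter_subset_left) fun x hx => hx.2)
    fun x hx => φ.jetChart.map_target hx.1

lemma BundleChart.contMDiffOn_of_rep (φ : BundleChart B) {V : (z : J1 B) → TJ z}
    {W : Set (J1 B)} (hW : W ⊆ φ.jetChart.source) {g : J1 B → Jet m}
    (hg : ContMDiffOn 𝓘(ℝ, Jet m) 𝓘(ℝ, Jet m) ∞ g W)
    (hV : ∀ z ∈ W, φ.dJet z (V z) = g z) :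
    ContMDiffOn 𝓘(ℝ, Jet m) 𝓘(ℝ, Jet m).tangent ∞
      (fun z => (⟨z, V z⟩ : TangentBundle 𝓘(ℝ, Jet m) (J1 B))) W := by
  refine (φ.contMDiffOn_dJetSymm (φ.contMDiffOn_jetChart.mono hW) hg
    fun z hz => φ.jetChart.map_source (hW hz)).congr fun z hz => ?_
  rw [← hV z hz]
  -- The base points of the two sides are only propositionally equal. At a point of the form
  -- `φ.jetChart.symm x` a rewrite with `right_inv` removes the mismatch.
  refine φ.forall_of_symm (p := fun z => (⟨z, V z⟩ : TangentBundle 𝓘(ℝ, Jet m) (J1 B)) =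
    ⟨φ.jetChart.symm (φ.jetChart z), φ.dJetSymm (φ.jetChart z) (φ.dJet z (V z))⟩)
    (fun x hx => ?_) (hW hz)
  rw [φ.jetChart.right_inv hx, φ.dJetSymm_dJet hx]

/-- A fibrewise map `TJ¹Q → TJ¹Q` with smooth coordinate expression is smooth. -/
lemma BundleChart.contMDiffOn_endo (φ : BundleChart B) {P : (z : J1 B) → TJ z → TJ z}
    {c : Jet m × Jet m → Jet m} (hc : ContDiffOn ℝ ∞ c (φ.jetChart.target ×ˢ univ))
    (hP : ∀ z ∈ φ.jetChart.source, ∀ w : TJ z,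
      φ.dJet z (P z w) = c (φ.jetChart z, φ.dJet z w)) :
    ContMDiffOn 𝓘(ℝ, Jet m).tangent 𝓘(ℝ, Jet m).tangent ∞
      (fun w : TangentBundle 𝓘(ℝ, Jet m) (J1 B) =>
        (⟨w.1, P w.1 w.2⟩ : TangentBundle 𝓘(ℝ, Jet m) (J1 B)))
      (TotalSpace.proj ⁻¹' φ.jetChart.source) := by
  have hx : ContMDiffOn 𝓘(ℝ, Jet m).tangent 𝓘(ℝ, Jet m) ∞
      (fun w : TangentBundle 𝓘(ℝ, Jet m) (J1 B) => φ.jetChart w.1)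
      (TotalSpace.proj ⁻¹' φ.jetChart.source) :=
    φ.contMDiffOn_jetChart.comp (Bundle.contMDiff_proj _).contMDiffOn (fun w hw => hw)
  have hg := hc.contMDiffOn.comp (hx.prodMk_space φ.contMDiffOn_dJet)
    (fun w hw => ⟨φ.jetChart.map_source hw, mem_univ _⟩)
  refine (φ.contMDiffOn_dJetSymm hx hg fun w hw => φ.jetChart.map_source hw).congr
    fun w hw => ?_
  rw [Function.comp_apply, ← hP w.1 hw]
  refine φ.forall_of_symm (p := fun z => ∀ v : TJ z,
    (⟨z, v⟩ : TangentBundle 𝓘(ℝ, Jet m) (J1 B)) =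
    ⟨φ.jetChart.symm (φ.jetChart z), φ.dJetSymm (φ.jetChart z) (φ.dJet z v)⟩)
    (fun x hx v => ?_) hw _
  rw [φ.jetChart.right_inv hx, φ.dJetSymm_dJet hx]

/-- A smooth fibrewise map `TJ¹Q → TJ¹Q` has smooth coordinate expressions. -/
lemma BundleChart.contDiffOn_rep_endo (φ : BundleChart B) {P : (z : J1 B) → TJ z → TJ z}
    (hP : ContMDiff 𝓘(ℝ, Jet m).tangent 𝓘(ℝ, Jet m).tangent ∞
      (fun w : TangentBundle 𝓘(ℝ, Jet m) (J1 B) =>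
        (⟨w.1, P w.1 w.2⟩ : TangentBundle 𝓘(ℝ, Jet m) (J1 B)))) (a : Jet m) :
    ContDiffOn ℝ ∞ (fun x => φ.dJet (φ.jetChart.symm x)
      (P (φ.jetChart.symm x) (φ.dJetSymm x a))) φ.jetChart.target := by
  rw [← contMDiffOn_iff_contDiffOn]
  exact φ.contMDiffOn_dJet.comp
    (hP.comp_contMDiffOn (φ.contMDiffOn_dJetSymm contMDiffOn_id contMDiffOn_const
      (mapsTo_id _))) fun x hx => φ.jetChart.map_target hx

end Smoothness

/-! ### The Lie bracket in jet coordinates -/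

section Bracket

/-- Identifies the coordinate expression with a pullback, so that naturality of the Lie bracket
applies to it. -/
lemma BundleChart.mpullback_symm (φ : BundleChart B) (V : (z : J1 B) → TJ z) {x : Jet m}
    (hx : x ∈ φ.jetChart.target) :
    VectorField.mpullback 𝓘(ℝ, Jet m) 𝓘(ℝ, Jet m) φ.jetChart.symm V x = φ.rep V x := by
  have h : ContinuousLinearMap.inverse (φ.dJetSymm x) = φ.dJet (φ.jetChart.symm x) := by
    refine ContinuousLinearMap.inverse_eq ?_ ?_
    · ext w : 1
      exact φ.dJetSymm_dJet hx w
    · refine ContinuousLinearMap.ext fun w => ?_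
      exact φ.dJet_dJetSymm hx w
  exact DFunLike.congr_fun h (V (φ.jetChart.symm x))

lemma BundleChart.rep_mlieBracket (φ : BundleChart B) {V W : (z : J1 B) → TJ z} {x : Jet m}
    (hx : x ∈ φ.jetChart.target)
    (hV : MDifferentiableAt 𝓘(ℝ, Jet m) 𝓘(ℝ, Jet m).tangent
      (fun z => (⟨z, V z⟩ : TangentBundle 𝓘(ℝ, Jet m) (J1 B))) (φ.jetChart.symm x))
    (hW : MDifferentiableAt 𝓘(ℝ, Jet m) 𝓘(ℝ, Jet m).tangent
      (fun z => (⟨z, W z⟩ : TangentBundle 𝓘(ℝ, Jet m) (J1 B))) (φ.jetChart.symm x)) :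
    φ.rep (VectorField.mlieBracket 𝓘(ℝ, Jet m) V W) x =
      VectorField.lieBracket ℝ (φ.rep V) (φ.rep W) x := by
  have hf : ContMDiffAt 𝓘(ℝ, Jet m) 𝓘(ℝ, Jet m) ∞ φ.jetChart.symm x :=
    φ.contMDiffOn_jetChart_symm.contMDiffAt (φ.jetChart.open_target.mem_nhds hx)
  -- Naturality of the bracket rests on symmetry of second derivatives; over `ℝ` the required
  -- regularity is just `C²`.
  have h2 : minSmoothness ℝ 2 ≤ ∞ := by
    rw [minSmoothness_of_isRCLikeNormedField]
    exact WithTop.coe_le_coe.2 (le_top : (2 : ℕ∞) ≤ ⊤)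
  have : IsManifold 𝓘(ℝ, Jet m) (minSmoothness ℝ 2) (J1 B) := IsManifold.of_le (n := ∞) h2
  have h := VectorField.mpullback_mlieBracket (n := ∞) hV hW hf h2
  rw [φ.mpullback_symm _ hx] at h
  have hev : ∀ V : (z : J1 B) → TJ z,
      VectorField.mpullback 𝓘(ℝ, Jet m) 𝓘(ℝ, Jet m) φ.jetChart.symm V =ᶠ[𝓝 x] φ.rep V := by
    intro V
    filter_upwards [φ.jetChart.open_target.mem_nhds hx] with y hy
    exact φ.mpullback_symm V hy
  refine (h.trans ((hev V).mlieBracket_vectorField_eq (hev W) (I := 𝓘(ℝ, Jet m)))).trans ?_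
  exact congrFun ((VectorField.mlieBracketWithin_eq_lieBracketWithin (V := φ.rep V)
    (W := φ.rep W)).trans VectorField.lieBracketWithin_univ) x

end Bracket

/-! ### Holonomic connections and the coordinate form of the bracket expression -/

section HolonomicCoordinates

variable (φ : BundleChart B) (ξ : HolonomicConnection B)

/-- The components `ξ^i` of a holonomic connection, as functions of the coordinates. -/
def BundleChart.xi (x : Jet m) : Fib m := (φ.rep ξ.field x).2

/-- The derivative `∂_j^t ξ^i` of the components of a holonomic connection along the fibres
of `J¹Q → Q`. -/
def BundleChart.dxi (x : Jet m) : Fib m →L[ℝ] Fib m :=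
  (fderiv ℝ (φ.xi ξ) x).comp (ContinuousLinearMap.inr ℝ (Base m) (Fib m))

lemma BundleChart.dJet_field_fst {z : J1 B} (hz : jetProj B z ∈ φ.coord.source) :
    (φ.dJet z (ξ.field z)).1 = ((1 : ℝ), (φ.jetChart z).2) := by
  rw [← φ.d_dProj hz, ← φ.d_vel hz]
  exact congrArg _ (ξ.2 z)

lemma BundleChart.rep_field {x : Jet m} (hx : x ∈ φ.jetChart.target) :
    φ.rep ξ.field x = (((1 : ℝ), x.2), φ.xi ξ x) := by
  refine Prod.ext ?_ rfl
  refine (φ.dJet_field_fst ξ (φ.jetProj_symm_mem hx)).trans ?_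
  rw [φ.jetChart.right_inv hx]

/-- Smoothness of a connection is given for its horizontal projection. Any vector with `dt = 1` is
projected to `ξ`, so the projection is evaluated on the constant coordinate vector `∂_t`. -/
lemma BundleChart.contDiffOn_rep_field : ContDiffOn ℝ ∞ (φ.rep ξ.field) φ.jetChart.target := by
  refine (φ.contDiffOn_rep_endo (P := fun z w => ξ.1.lift z (dtJ z w)) ξ.1.smooth
    (((1 : ℝ), (0 : Fib m)), (0 : Fib m))).congr fun x hx => ?_
  have h : dtJ (φ.jetChart.symm x) (φ.dJetSymm x (((1 : ℝ), (0 : Fib m)), (0 : Fib m))) =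
      (1 : ℝ) := by
    rw [← φ.dJet_fst_fst (φ.jetProj_symm_mem hx), φ.dJet_dJetSymm hx]
  have h2 := congrArg (fun t : ℝ => φ.dJet (φ.jetChart.symm x) (ξ.1.lift (φ.jetChart.symm x) t)) h
  exact h2.symm

lemma BundleChart.contDiffOn_xi : ContDiffOn ℝ ∞ (φ.xi ξ) φ.jetChart.target :=
  contDiff_snd.comp_contDiffOn (φ.contDiffOn_rep_field ξ)

lemma BundleChart.contDiffOn_dxi : ContDiffOn ℝ ∞ (φ.dxi ξ) φ.jetChart.target :=
  ((φ.contDiffOn_xi ξ).fderiv_of_isOpen φ.jetChart.open_target (m := ∞) (by simp)).clm_comp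
    contDiffOn_const

lemma HolonomicConnection.contMDiffAt_field (z : J1 B) :
    ContMDiffAt 𝓘(ℝ, Jet m) 𝓘(ℝ, Jet m).tangent ∞
      (fun z => (⟨z, ξ.field z⟩ : TangentBundle 𝓘(ℝ, Jet m) (J1 B))) z := by
  obtain ⟨φ, hz⟩ := exists_bundleChart B (jetProj B z)
  refine (φ.contMDiffOn_of_rep (g := φ.rep ξ.field ∘ φ.jetChart) subset_rfl
    ((φ.contDiffOn_rep_field ξ).contMDiffOn.comp φ.contMDiffOn_jetChart
      φ.jetChart.mapsTo) fun y hy => ?_).contMDiffAt (φ.jetChart.open_source.mem_nhds hz)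
  refine φ.forall_of_symm (p := fun y => φ.dJet y (ξ.field y) =
    (φ.rep ξ.field ∘ φ.jetChart) y) (fun x hx => ?_) hy
  rw [Function.comp_apply, φ.jetChart.right_inv hx]
  rfl

/-- The coordinate expression of `I_ξ`. -/
def BundleChart.bracketMap (x : Jet m) : Jet m →ₗ[ℝ] Jet m where
  toFun a := (((0 : ℝ), -a.1.2), a.2 - φ.dxi ξ x a.1.2)
  map_add' a b := by
    ext <;> simp
    all_goals ring
  map_smul' c a := by
    ext <;> simp
    all_goals ring

lemma BundleChart.bracketMap_apply (x a : Jet m) :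
    φ.bracketMap ξ x a = (((0 : ℝ), -a.1.2), a.2 - φ.dxi ξ x a.1.2) := rfl

lemma BundleChart.rep_vHat (u : (z : J1 B) → TJ z) {x : Jet m} (hx : x ∈ φ.jetChart.target) :
    φ.rep (fun y => vHat y (u y)) x =
      ((0 : Base m), (φ.rep u x).1.2 - (φ.rep u x).1.1 • x.2) := by
  refine (φ.dJet_vHat (φ.jetProj_symm_mem hx) _).trans ?_
  rw [φ.jetChart.right_inv hx]
  rfl

lemma contMDiffOn_vHat {u : (z : J1 B) → TJ z} {W : Set (J1 B)} (hW : IsOpen W)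
    (hu : ContMDiffOn 𝓘(ℝ, Jet m) 𝓘(ℝ, Jet m).tangent ∞
      (fun z => (⟨z, u z⟩ : TangentBundle 𝓘(ℝ, Jet m) (J1 B))) W) :
    ContMDiffOn 𝓘(ℝ, Jet m) 𝓘(ℝ, Jet m).tangent ∞
      (fun z => (⟨z, vHat z (u z)⟩ : TangentBundle 𝓘(ℝ, Jet m) (J1 B))) W := by
  intro z hzW
  obtain ⟨φ, hz⟩ := exists_bundleChart B (jetProj B z)
  have hs : IsOpen (W ∩ φ.jetChart.source) := hW.inter φ.jetChart.open_source
  have h1 : ContMDiffOn 𝓘(ℝ, Jet m) 𝓘(ℝ, Jet m) ∞ (fun y => φ.dJet y (u y))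
      (W ∩ φ.jetChart.source) :=
    φ.contMDiffOn_dJet.comp (hu.mono inter_subset_left) fun y hy => hy.2
  have hc : ContDiff ℝ ∞ (fun p : Jet m × Jet m =>
      (((0 : Base m), p.2.1.2 - p.2.1.1 • p.1.2) : Jet m)) := by
    fun_prop
  exact ((φ.contMDiffOn_of_rep inter_subset_right
    (hc.contMDiff.comp_contMDiffOn
      ((φ.contMDiffOn_jetChart.mono inter_subset_right).prodMk_space h1))
    fun y hy => φ.dJet_vHat hy.2 _).contMDiffAt (hs.mem_nhds ⟨hzW, hz⟩)).contMDiffWithinAt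

/-- The derivatives of the components of `u` along `ξ` cancel between the two brackets, so the
result depends only on the value of `u` at the point. -/
lemma BundleChart.dJet_bracket {u : (z : J1 B) → TJ z} {W : Set (J1 B)} (hW : IsOpen W)
    (hu : ContMDiffOn 𝓘(ℝ, Jet m) 𝓘(ℝ, Jet m).tangent ∞
      (fun z => (⟨z, u z⟩ : TangentBundle 𝓘(ℝ, Jet m) (J1 B))) W)
    (hv : ∀ z ∈ W, u z ∈ VJ z) {x : Jet m} (hx : x ∈ φ.jetChart.target)
    (hxW : φ.jetChart.symm x ∈ W) :
    φ.dJet (φ.jetChart.symm x)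
      (VectorField.mlieBracket 𝓘(ℝ, Jet m) ξ.field (fun y => vHat y (u y)) (φ.jetChart.symm x) -
        vHat (φ.jetChart.symm x)
          (VectorField.mlieBracket 𝓘(ℝ, Jet m) ξ.field u (φ.jetChart.symm x))) =
      φ.bracketMap ξ x (φ.dJet (φ.jetChart.symm x) (u (φ.jetChart.symm x))) := by
  have hξ := (ξ.contMDiffAt_field (φ.jetChart.symm x)).mdifferentiableAt (by simp)
  have hum := (hu.contMDiffAt (hW.mem_nhds hxW)).mdifferentiableAt (by simp)
  have hvm := ((contMDiffOn_vHat hW hu).contMDiffAt (hW.mem_nhds hxW)).mdifferentiableAt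
    (by simp)
  have hS : IsOpen (φ.jetChart.target ∩ φ.jetChart.symm ⁻¹' W) :=
    φ.jetChart.symm.isOpen_inter_preimage hW
  have hnhds := hS.mem_nhds ⟨hx, hxW⟩
  have hr : DifferentiableAt ℝ (φ.rep u) x :=
    ((φ.contDiffOn_rep hu).contDiffAt hnhds).differentiableAt (by simp)
  have hX : DifferentiableAt ℝ (φ.xi ξ) x :=
    ((φ.contDiffOn_xi ξ).contDiffAt (φ.jetChart.open_target.mem_nhds hx)).differentiableAt
      (by simp)
  set D := fderiv ℝ (φ.rep u) x with hD
  have hr0 : ∀ y ∈ φ.jetChart.target ∩ φ.jetChart.symm ⁻¹' W, (φ.rep u y).1.1 = 0 := by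
    intro y hy
    exact (φ.dJet_fst_fst (φ.jetProj_symm_mem hy.1) _).trans (hv _ hy.2)
  -- The `dt` component of `u` vanishes on a whole neighbourhood, hence so does its derivative. This
  -- makes `[ξ, u]` vertical and kills the `-q^i_t` term of `v̂`.
  have hD0 : ∀ a, (D a).1.1 = 0 := by
    intro a
    have h1 : HasFDerivAt (fun y => (φ.rep u y).1.1)
        ((ContinuousLinearMap.fst ℝ ℝ (Fib m)).comp
          ((ContinuousLinearMap.fst ℝ (Base m) (Fib m)).comp D)) x :=
      hr.hasFDerivAt.fst.fst
    have h2 : (fun y => (φ.rep u y).1.1) =ᶠ[𝓝 x] fun _ => (0 : ℝ) := by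
      filter_upwards [hnhds] with y hy using hr0 y hy
    have h3 := h1.unique ((hasFDerivAt_const (0 : ℝ) x).congr_of_eventuallyEq h2)
    exact DFunLike.congr_fun h3 a
  have hDv : HasFDerivAt (φ.rep fun y => vHat y (u y))
      ((0 : Jet m →L[ℝ] Base m).prod ((ContinuousLinearMap.snd ℝ ℝ (Fib m)).comp
          ((ContinuousLinearMap.fst ℝ (Base m) (Fib m)).comp D))) x := by
    refine ((hasFDerivAt_const (0 : Base m) x).prodMk hr.hasFDerivAt.fst.snd).congr_of_eventuallyEq
      ?_
    filter_upwards [hnhds] with y hy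
    rw [φ.rep_vHat u hy.1, hr0 y hy, zero_smul, sub_zero]
  have hDξ : HasFDerivAt (φ.rep ξ.field)
      (((0 : Jet m →L[ℝ] ℝ).prod (ContinuousLinearMap.snd ℝ (Base m) (Fib m))).prod
        (fderiv ℝ (φ.xi ξ) x)) x := by
    refine (((hasFDerivAt_const (1 : ℝ) x).prodMk hasFDerivAt_snd).prodMk
      hX.hasFDerivAt).congr_of_eventuallyEq ?_
    filter_upwards [φ.jetChart.open_target.mem_nhds hx] with y hy
    exact φ.rep_field ξ hy
  have hb1 := φ.rep_mlieBracket hx hξ hvm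
  have hb2 := φ.rep_mlieBracket hx hξ hum
  have hb3 := φ.rep_vHat (VectorField.mlieBracket 𝓘(ℝ, Jet m) ξ.field u) hx
  rw [hb2] at hb3
  rw [map_sub]
  change φ.rep (VectorField.mlieBracket 𝓘(ℝ, Jet m) ξ.field fun y => vHat y (u y)) x -
    φ.rep (fun y => vHat y (VectorField.mlieBracket 𝓘(ℝ, Jet m) ξ.field u y)) x =
    φ.bracketMap ξ x (φ.rep u x)
  have hrx := hr0 x ⟨hx, hxW⟩
  have hvx : φ.rep (fun y => vHat y (u y)) x = ((0 : Base m), (φ.rep u x).1.2) := by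
    rw [φ.rep_vHat u hx, hrx, zero_smul, sub_zero]
  have hdxi : φ.dxi ξ x (φ.rep u x).1.2 =
    fderiv ℝ (φ.xi ξ) x ((0 : Base m), (φ.rep u x).1.2) := rfl
  rw [hb3, hb1, VectorField.lieBracket, VectorField.lieBracket, hDv.fderiv, hDξ.fderiv, ← hD, hvx,
    φ.bracketMap_apply, hdxi]
  ext <;> simp [hD0]

end HolonomicCoordinates

/-! ### Existence and uniqueness of the bracket endomorphism -/

section BracketEndomorphism

variable (ξ : HolonomicConnection B)

/-- The bracket endomorphism `I_ξ` of `VJ¹Q`. -/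
def HolonomicConnection.bracketEndo : VerticalEndo B := fun z =>
  let φ := (exists_bundleChart B (jetProj B z)).choose
  have hz : jetProj B z ∈ φ.coord.source := (exists_bundleChart B (jetProj B z)).choose_spec
  LinearMap.codRestrict (VJ z)
    ((φ.jetEquiv hz).symm.toLinearMap ∘ₗ φ.bracketMap ξ (φ.jetChart z) ∘ₗ
      (φ.jetEquiv hz).toLinearMap ∘ₗ (VJ z).subtype) fun v => by
    change dtJ z _ = 0
    rw [← φ.dJet_fst_fst hz, ← φ.jetEquiv_apply hz]
    exact congrArg (fun a : Jet m => a.1.1) ((φ.jetEquiv hz).apply_symm_apply _)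

lemma HolonomicConnection.isBracketEndo_bracketEndo : IsBracketEndo ξ ξ.bracketEndo := by
  intro W u hW hu hv z hzW
  let φ := (exists_bundleChart B (jetProj B z)).choose
  have hz : jetProj B z ∈ φ.coord.source := (exists_bundleChart B (jetProj B z)).choose_spec
  apply φ.dJet_injective hz
  have h1 : φ.dJet z (ξ.bracketEndo z ⟨u z, hv z hzW⟩) =
      φ.bracketMap ξ (φ.jetChart z) (φ.dJet z (u z)) :=
    (φ.jetEquiv hz).apply_symm_apply _
  rw [h1]
  -- The chart `φ` was chosen from `z`; a separate point `y` can be moved through the chart while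
  -- `φ` stays fixed.
  have key : ∀ y, jetProj B y ∈ φ.coord.source → y ∈ W →
      φ.bracketMap ξ (φ.jetChart y) (φ.dJet y (u y)) =
      φ.dJet y (VectorField.mlieBracket 𝓘(ℝ, Jet m) ξ.field (fun y => vHat y (u y)) y -
          vHat y (VectorField.mlieBracket 𝓘(ℝ, Jet m) ξ.field u y)) := by
    intro y hy
    refine φ.forall_of_symm (p := fun y => y ∈ W →
      φ.bracketMap ξ (φ.jetChart y) (φ.dJet y (u y)) =
      φ.dJet y (VectorField.mlieBracket 𝓘(ℝ, Jet m) ξ.field (fun y => vHat y (u y)) y -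
          vHat y (VectorField.mlieBracket 𝓘(ℝ, Jet m) ξ.field u y))) (fun x hx hxW => ?_) hy
    rw [φ.dJet_bracket ξ hW hu hv hx hxW, φ.jetChart.right_inv hx]
  exact key z hz hzW

/-- The vector field with constant components in a jet chart. -/
def BundleChart.constField (φ : BundleChart B) (a : Jet m) (z : J1 B) : TJ z :=
  (φ.dJetSymm (φ.jetChart z) a : Jet m)

lemma BundleChart.dJet_constField (φ : BundleChart B) (a : Jet m) {z : J1 B}
    (hz : jetProj B z ∈ φ.coord.source) : φ.dJet z (φ.constField a z) = a :=
  (φ.jetEquiv hz).apply_symm_apply a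

/-- A vertical vector extends to the field with constant components in the chart, which is again
vertical, so the bracket identity determines `I` on it. This gives both uniqueness and a formula
valid in every chart, not only in the one used to construct `I_ξ`. -/
lemma IsBracketEndo.dJet_apply {ξ : HolonomicConnection B} {I : VerticalEndo B}
    (hI : IsBracketEndo ξ I) (φ : BundleChart B) {z : J1 B}
    (hz : jetProj B z ∈ φ.coord.source) (v : VJ z) :
    φ.dJet z (I z v) = φ.bracketMap ξ (φ.jetChart z) (φ.dJet z v) := by
  have key : ∀ y, jetProj B y ∈ φ.coord.source → ∀ v : VJ y,
      φ.dJet y (I y v) = φ.bracketMap ξ (φ.jetChart y) (φ.dJet y v) := by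
    intro y hy
    refine φ.forall_of_symm (p := fun y => ∀ v : VJ y,
      φ.dJet y (I y v) = φ.bracketMap ξ (φ.jetChart y) (φ.dJet y v)) (fun x hx v => ?_) hy
    set a : Jet m := φ.dJet (φ.jetChart.symm x) v with ha
    have hu : ContMDiffOn 𝓘(ℝ, Jet m) 𝓘(ℝ, Jet m).tangent ∞
        (fun z => (⟨z, φ.constField a z⟩ : TangentBundle 𝓘(ℝ, Jet m) (J1 B)))
        φ.jetChart.source :=
      φ.contMDiffOn_of_rep subset_rfl contMDiffOn_const fun z hz => φ.dJet_constField a hz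
    have ha0 : a.1.1 = 0 :=
      (φ.dJet_fst_fst (φ.jetProj_symm_mem hx) _).trans v.2
    have hv : ∀ z ∈ φ.jetChart.source, φ.constField a z ∈ VJ z := by
      intro z hz
      change dtJ z _ = 0
      rw [← φ.dJet_fst_fst hz, φ.dJet_constField a hz, ha0]
    have hxs := φ.jetChart.map_target hx
    have h1 := hI φ.jetChart.source (φ.constField a) φ.jetChart.open_source hu hv _ hxs
    have h2 : (⟨φ.constField a (φ.jetChart.symm x), hv _ hxs⟩ : VJ (φ.jetChart.symm x)) = v :=
      Subtype.ext (φ.dJet_injective (φ.jetProj_symm_mem hx) (φ.dJet_constField a hxs))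
    rw [h2] at h1
    rw [h1, φ.dJet_bracket ξ φ.jetChart.open_source hu hv hx hxs, φ.dJet_constField a hxs,
      φ.jetChart.right_inv hx]
  exact key z hz v

lemma IsBracketEndo.unique {ξ : HolonomicConnection B} {I I' : VerticalEndo B}
    (hI : IsBracketEndo ξ I) (hI' : IsBracketEndo ξ I') : I' = I := by
  funext z
  obtain ⟨φ, hz⟩ := exists_bundleChart B (jetProj B z)
  refine LinearMap.ext fun v => Subtype.ext (φ.dJet_injective hz ?_)
  rw [hI.dJet_apply φ hz, hI'.dJet_apply φ hz]

end BracketEndomorphism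

/-! ### The dynamic connection of a holonomic connection -/

section InducedConnection

variable (ξ : HolonomicConnection B)

/-- The coordinate expression of the horizontal lift of `γ_ξ`. -/
def BundleChart.liftMap (φ : BundleChart B) (ξ : HolonomicConnection B) (x : Jet m) :
    Base m →L[ℝ] Jet m :=
  (ContinuousLinearMap.id ℝ (Base m)).prod
    ((ContinuousLinearMap.fst ℝ ℝ (Fib m)).smulRight (φ.xi ξ x) +
      (1 / 2 : ℝ) • (φ.dxi ξ x).comp (ContinuousLinearMap.snd ℝ ℝ (Fib m) -
        (ContinuousLinearMap.fst ℝ ℝ (Fib m)).smulRight x.2))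

lemma BundleChart.liftMap_apply (φ : BundleChart B) (x : Jet m) (a : Base m) :
    φ.liftMap ξ x a =
      (a, a.1 • φ.xi ξ x + (1 / 2 : ℝ) • φ.dxi ξ x (a.2 - a.1 • x.2)) := rfl

/-- The left side is the complementary projection `Id - J_ξ ∘ ξ̂`. Only the `TQ` part of `w`
survives on the right, so the projection factors through `dProj` and defines a horizontal lift. -/
lemma IsBracketEndo.dJet_sub {ξ : HolonomicConnection B} {I : VerticalEndo B}
    (hI : IsBracketEndo ξ I) (φ : BundleChart B) {z : J1 B}
    (hz : jetProj B z ∈ φ.coord.source) (w : TJ z) :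
    φ.dJet z (w - (((1 / 2 : ℝ) • (I z (ξ.vertProj z w) + ξ.vertProj z w) : VJ z) : TJ z)) =
      φ.liftMap ξ (φ.jetChart z) (φ.dJet z w).1 := by
  have hF : φ.dJet z (ξ.field z) = (((1 : ℝ), (φ.jetChart z).2), φ.xi ξ (φ.jetChart z)) := by
    refine Prod.ext (φ.dJet_field_fst ξ hz) ?_
    change _ = (φ.dJet (φ.jetChart.symm (φ.jetChart z))
      (ξ.field (φ.jetChart.symm (φ.jetChart z)))).2
    rw [φ.jetChart.left_inv hz]
  have hv : φ.dJet z (ξ.vertProj z w : TJ z) = φ.dJet z w - (φ.dJet z w).1.1 •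
      (((1 : ℝ), (φ.jetChart z).2), φ.xi ξ (φ.jetChart z)) := by
    change φ.dJet z (w - dtJ z w • ξ.field z) = _
    rw [map_sub, map_smul, hF, φ.dJet_fst_fst hz]
  have h1 : (((1 / 2 : ℝ) • (I z (ξ.vertProj z w) + ξ.vertProj z w) : VJ z) : TJ z) =
      (1 / 2 : ℝ) • ((I z (ξ.vertProj z w) : TJ z) + (ξ.vertProj z w : TJ z)) := rfl
  rw [h1, map_sub, map_smul, map_add, hI.dJet_apply φ hz, hv, φ.bracketMap_apply,
    φ.liftMap_apply]
  set a := φ.dJet z w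
  -- In the `∂_i` slot `I` contributes minus the identity, so `J` vanishes there. In the `∂^t_i`
  -- slot the two halves add up to the full component, and half of the `∂^t_j ξ^i` term remains.
  refine Prod.ext (Prod.ext ?_ ?_) ?_
  · simp
  · simp only [Prod.fst_sub, Prod.snd_sub, Prod.fst_add, Prod.snd_add, Prod.smul_fst,
      Prod.smul_snd]
    module
  · simp only [Prod.fst_sub, Prod.snd_sub, Prod.snd_add, Prod.smul_fst, Prod.smul_snd]
    module

/-- The horizontal lift of `γ_ξ`. -/
def HolonomicConnection.inducedLift (z : J1 B) :
    TangentSpace 𝓘(ℝ, Base m) (jetProj B z) →L[ℝ] TJ z :=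
  let φ := (exists_bundleChart B (jetProj B z)).choose
  have hz : jetProj B z ∈ φ.coord.source := (exists_bundleChart B (jetProj B z)).choose_spec
  (φ.jetEquiv hz).symm.toContinuousLinearMap.comp
    ((φ.liftMap ξ (φ.jetChart z)).comp (φ.d (jetProj B z)))

lemma BundleChart.dProj_surjective (φ : BundleChart B) {z : J1 B}
    (hz : jetProj B z ∈ φ.coord.source) : Function.Surjective (dProj z) := fun v => by
  refine ⟨(φ.jetEquiv hz).symm (φ.d _ v, 0), φ.d_injective hz ?_⟩
  rw [φ.d_dProj hz, ← φ.jetEquiv_apply hz, (φ.jetEquiv hz).apply_symm_apply]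

lemma HolonomicConnection.inducedLift_dProj (z : J1 B) (w : TJ z) :
    ξ.inducedLift z (dProj z w) = w - (((1 / 2 : ℝ) •
      (ξ.bracketEndo z (ξ.vertProj z w) + ξ.vertProj z w) : VJ z) : TJ z) := by
  let φ := (exists_bundleChart B (jetProj B z)).choose
  have hz : jetProj B z ∈ φ.coord.source := (exists_bundleChart B (jetProj B z)).choose_spec
  apply φ.dJet_injective hz
  rw [ξ.isBracketEndo_bracketEndo.dJet_sub φ hz, ← φ.d_dProj hz]
  exact (φ.jetEquiv hz).apply_symm_apply _

/-- The lift was built in one chosen chart. Its formula passes to all charts because every vector of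
`TQ` is some `dProj z w`, and on such vectors the lift is `w - J_ξ(ξ̂ w)`, which involves no chart.
-/
lemma BundleChart.dJet_inducedLift (φ : BundleChart B) {z : J1 B}
    (hz : jetProj B z ∈ φ.coord.source) (v : TangentSpace 𝓘(ℝ, Base m) (jetProj B z)) :
    φ.dJet z (ξ.inducedLift z v) = φ.liftMap ξ (φ.jetChart z) (φ.d _ v) := by
  obtain ⟨w, rfl⟩ := φ.dProj_surjective hz v
  rw [ξ.inducedLift_dProj, ξ.isBracketEndo_bracketEndo.dJet_sub φ hz, φ.d_dProj hz]

/-- The dynamic connection `γ_ξ` defined by a holonomic connection `ξ`. -/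
def HolonomicConnection.toDynamic : DynamicConnection B where
  lift := ξ.inducedLift
  mfderiv_lift z v := by
    obtain ⟨φ, hz⟩ := exists_bundleChart B (jetProj B z)
    apply φ.d_injective hz
    refine (φ.d_dProj hz (ξ.inducedLift z v)).trans ?_
    rw [φ.dJet_inducedLift ξ hz]
    rfl
  smooth := by
    intro w₀
    obtain ⟨φ, hz⟩ := exists_bundleChart B (jetProj B w₀.1)
    refine (φ.contMDiffOn_endo (P := fun z w => ξ.inducedLift z (dProj z w))
      (c := fun p => (p.2.1, p.2.1.1 • φ.xi ξ p.1 +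
        (1 / 2 : ℝ) • φ.dxi ξ p.1 (p.2.1.2 - p.2.1.1 • p.1.2))) ?_ ?_).contMDiffAt
      ((φ.jetChart.open_source.preimage (FiberBundle.continuous_proj _ _)).mem_nhds hz)
    · have h1 : ContDiffOn ℝ ∞ (fun p : Jet m × Jet m => φ.xi ξ p.1)
          (φ.jetChart.target ×ˢ univ) :=
        (φ.contDiffOn_xi ξ).comp contDiff_fst.contDiffOn fun p hp => hp.1
      have h2 : ContDiffOn ℝ ∞ (fun p : Jet m × Jet m => φ.dxi ξ p.1)
          (φ.jetChart.target ×ˢ univ) :=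
        (φ.contDiffOn_dxi ξ).comp contDiff_fst.contDiffOn fun p hp => hp.1
      have h3 : ContDiff ℝ ∞ (fun p : Jet m × Jet m => p.2.1.2 - p.2.1.1 • p.1.2) := by
        fun_prop
      have h4 : ContDiff ℝ ∞ (fun p : Jet m × Jet m => p.2.1.1) := by fun_prop
      have h5 : ContDiff ℝ ∞ (fun p : Jet m × Jet m => p.2.1) := by fun_prop
      exact h5.contDiffOn.prodMk ((h4.contDiffOn.smul h1).add
        ((h2.clm_apply h3.contDiffOn).const_smul (1 / 2 : ℝ)))
    · intro z hz w
      rw [φ.dJet_inducedLift ξ hz, φ.d_dProj hz]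
      rfl

lemma HolonomicConnection.toDynamic_vertProj (z : J1 B) (w : TJ z) :
    ξ.toDynamic.vertProj z w = (((1 / 2 : ℝ) •
      (ξ.bracketEndo z (ξ.vertProj z w) + ξ.vertProj z w) : VJ z) : TJ z) := by
  change w - ξ.inducedLift z (dProj z w) = _
  rw [ξ.inducedLift_dProj, sub_sub_cancel]

end InducedConnection

/-! ### Components, symmetry, and the correspondence between the two kinds of connection -/

section Components

variable (φ : BundleChart B)

lemma BundleChart.xi_jetChart (ξ : HolonomicConnection B) {z : J1 B}
    (hz : jetProj B z ∈ φ.coord.source) (i : Fin m) :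
    φ.xi ξ (φ.jetChart z) i = xiComp φ ξ i z := by
  change xiComp φ ξ i (φ.jetChart.symm (φ.jetChart z)) = _
  rw [φ.jetChart.left_inv hz]

lemma BundleChart.dqt_xiComp (ξ : HolonomicConnection B) {z : J1 B}
    (hz : jetProj B z ∈ φ.coord.source) (i j : Fin m) :
    dqt φ j (xiComp φ ξ i) z =
      φ.dxi ξ (φ.jetChart z) (EuclideanSpace.single j (1 : ℝ)) i := by
  have hX : DifferentiableAt ℝ (φ.xi ξ) (φ.jetChart z) :=
    ((φ.contDiffOn_xi ξ).contDiffAt (φ.jetChart.open_target.mem_nhds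
      (φ.jetChart.map_source hz))).differentiableAt (by simp)
  have h := ((EuclideanSpace.proj i : Fib m →L[ℝ] ℝ).hasFDerivAt.comp _ hX.hasFDerivAt).fderiv
  exact DFunLike.congr_fun h _

lemma sum_smul_single (y : Fib m) :
    ∑ j, y j • EuclideanSpace.single j (1 : ℝ) = y := by
  ext i
  simp [Finset.sum_apply, Pi.single_apply]

lemma BundleChart.dxi_apply (ξ : HolonomicConnection B) {z : J1 B}
    (hz : jetProj B z ∈ φ.coord.source) (i : Fin m) (y : Fib m) :
    φ.dxi ξ (φ.jetChart z) y i = ∑ j, y j * dqt φ j (xiComp φ ξ i) z := by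
  conv_lhs => rw [← sum_smul_single y]
  simp [φ.dqt_xiComp ξ hz]

lemma BundleChart.gammaTime_toDynamic (ξ : HolonomicConnection B) {z : J1 B}
    (hz : jetProj B z ∈ φ.coord.source) (i : Fin m) :
    gammaTime φ ξ.toDynamic i z = xiComp φ ξ i z -
      (1 / 2) * ∑ j, qt φ j z * dqt φ j (xiComp φ ξ i) z := by
  change (φ.dJet z (ξ.inducedLift z _)).2 i = _
  rw [φ.dJet_inducedLift ξ hz, φ.d_coordVec hz, φ.liftMap_apply]
  simp only [one_smul, zero_sub, map_neg, smul_neg, PiLp.add_apply, PiLp.neg_apply,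
    PiLp.smul_apply, smul_eq_mul, φ.xi_jetChart ξ hz, φ.dxi_apply ξ hz]
  rfl

lemma BundleChart.gammaSpace_toDynamic (ξ : HolonomicConnection B) {z : J1 B}
    (hz : jetProj B z ∈ φ.coord.source) (i j : Fin m) :
    gammaSpace φ ξ.toDynamic i j z = (1 / 2) * dqt φ j (xiComp φ ξ i) z := by
  change (φ.dJet z (ξ.inducedLift z _)).2 i = _
  rw [φ.dJet_inducedLift ξ hz, φ.d_coordVec hz, φ.liftMap_apply, φ.dqt_xiComp ξ hz]
  simp

lemma BundleChart.dJet_lift_fst (γ : DynamicConnection B) {z : J1 B}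
    (hz : jetProj B z ∈ φ.coord.source) (v : TangentSpace 𝓘(ℝ, Base m) (jetProj B z)) :
    (φ.dJet z (γ.lift z v)).1 = φ.d _ v := by
  rw [← φ.d_dProj hz]
  exact congrArg _ (γ.mfderiv_lift z v)

/-- The horizontal lift of a dynamic connection in terms of its components. -/
lemma BundleChart.dJet_lift_snd (γ : DynamicConnection B) {z : J1 B}
    (hz : jetProj B z ∈ φ.coord.source) (v : TangentSpace 𝓘(ℝ, Base m) (jetProj B z))
    (i : Fin m) :
    (φ.dJet z (γ.lift z v)).2 i = (φ.d _ v).1 * gammaTime φ γ i z +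
      ∑ j, (φ.d _ v).2 j * gammaSpace φ γ i j z := by
  -- The lift is linear in the base vector; `L` is its `i`-th fibre component in the coordinate
  -- frame, and expanding its argument in that frame produces the components of `γ`.
  let L : Base m →ₗ[ℝ] ℝ :=
    { toFun := fun a => (φ.dJet z (γ.lift z (coordVec φ (jetProj B z) a))).2 i
      map_add' := fun a b => by
        have h : coordVec φ (jetProj B z) (a + b) =
            coordVec φ (jetProj B z) a + coordVec φ (jetProj B z) b :=
          φ.d_injective hz (by simp only [map_add, φ.d_coordVec hz])
        rw [h, map_add, map_add]
        rfl
      map_smul' := fun c a => by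
        have h : coordVec φ (jetProj B z) (c • a) = c • coordVec φ (jetProj B z) a :=
          φ.d_injective hz (by simp only [map_smul, φ.d_coordVec hz])
        rw [h, map_smul, map_smul]
        rfl }
  have key : ∀ a : Base m, L a = a.1 * L ((1 : ℝ), (0 : Fib m)) +
      ∑ j, a.2 j * L ((0 : ℝ), EuclideanSpace.single j (1 : ℝ)) := by
    intro a
    have ha : a = a.1 • ((1 : ℝ), (0 : Fib m)) +
        ∑ j, a.2 j • ((0 : ℝ), EuclideanSpace.single j (1 : ℝ)) := by
      refine Prod.ext ?_ ?_
      · simp [Prod.fst_sum]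
      · simp [Prod.snd_sum, sum_smul_single]
    conv_lhs => rw [ha]
    simp only [map_add, map_sum, map_smul, smul_eq_mul]
  have h := key (φ.d _ v)
  have h2 : L (φ.d _ v) = (φ.dJet z (γ.lift z v)).2 i := by
    change (φ.dJet z (γ.lift z (coordVec φ (jetProj B z) (φ.d _ v)))).2 i = _
    rw [φ.coordVec_d hz]
  exact h2.symm.trans h

lemma BundleChart.xiComp_toHolonomic (γ : DynamicConnection B) {z : J1 B}
    (hz : jetProj B z ∈ φ.coord.source) (i : Fin m) :
    xiComp φ γ.toHolonomic i z =
      gammaTime φ γ i z + ∑ j, qt φ j z * gammaSpace φ γ i j z := by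
  have h1 : γ.toHolonomic.field z = γ.lift z (vel z) := one_smul ℝ (γ.lift z (vel z))
  rw [xiComp, h1, φ.dJet_lift_snd γ hz, φ.d_vel hz, one_mul]
  rfl

lemma DynamicConnection.ext_components {γ γ' : DynamicConnection B}
    (h : ∀ (φ : BundleChart B) (z : J1 B), jetProj B z ∈ φ.coord.source → ∀ i : Fin m,
      gammaTime φ γ i z = gammaTime φ γ' i z ∧
      ∀ j, gammaSpace φ γ i j z = gammaSpace φ γ' i j z) : γ = γ' := by
  refine Connection.ext (funext fun z => ContinuousLinearMap.ext fun v => ?_)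
  obtain ⟨φ, hz⟩ := exists_bundleChart B (jetProj B z)
  apply φ.dJet_injective hz
  refine Prod.ext ?_ ?_
  · rw [φ.dJet_lift_fst γ hz, φ.dJet_lift_fst γ' hz]
  · ext i
    rw [φ.dJet_lift_snd γ hz, φ.dJet_lift_snd γ' hz, (h φ z hz i).1]
    simp only [(h φ z hz i).2]

/-- With `a` a coordinate basis vector this covers `γ^i_0` and `γ^i_j` at once, which the product
rule below needs. -/
lemma BundleChart.differentiableAt_lift (γ : DynamicConnection B) {z : J1 B}
    (hz : jetProj B z ∈ φ.coord.source) (a : Base m) (i : Fin m) :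
    DifferentiableAt ℝ (fun x => (φ.dJet (φ.jetChart.symm x) (γ.lift (φ.jetChart.symm x)
      (coordVec φ (jetProj B (φ.jetChart.symm x)) a))).2 i) (φ.jetChart z) := by
  have h1 := φ.contDiffOn_rep_endo (P := fun z w => γ.lift z (dProj z w)) γ.smooth
    (a, (0 : Fib m))
  have h2 : ContDiffOn ℝ ∞ (fun x => φ.dJet (φ.jetChart.symm x) (γ.lift (φ.jetChart.symm x)
      (coordVec φ (jetProj B (φ.jetChart.symm x)) a))) φ.jetChart.target := by
    refine h1.congr fun x hx => ?_
    have hs := φ.jetProj_symm_mem hx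
    -- Smoothness is known for the horizontal projection on `TJ¹Q`, so the base vector `a` is first
    -- lifted to `(a, 0)`; the choice of fibre component is immaterial.
    have h3 : dProj (φ.jetChart.symm x) (φ.dJetSymm x (a, (0 : Fib m))) =
        coordVec φ (jetProj B (φ.jetChart.symm x)) a := by
      apply φ.d_injective hs
      rw [φ.d_dProj hs, φ.dJet_dJetSymm hx, φ.d_coordVec hs]
    rw [h3]
  have h4 : DifferentiableAt ℝ (fun x => φ.dJet (φ.jetChart.symm x) (γ.lift (φ.jetChart.symm x)
      (coordVec φ (jetProj B (φ.jetChart.symm x)) a))) (φ.jetChart z) :=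
    (h2.contDiffAt (φ.jetChart.open_target.mem_nhds
      (φ.jetChart.map_source hz))).differentiableAt (by simp)
  exact ((EuclideanSpace.proj i : Fib m →L[ℝ] ℝ).differentiableAt).comp _ h4.snd

lemma BundleChart.dqt_congr {f g : J1 B → ℝ}
    (h : ∀ z, jetProj B z ∈ φ.coord.source → f z = g z) {z : J1 B}
    (hz : jetProj B z ∈ φ.coord.source) (i : Fin m) : dqt φ i f z = dqt φ i g z := by
  have h1 : f ∘ φ.jetChart.symm =ᶠ[𝓝 (φ.jetChart z)] g ∘ φ.jetChart.symm := by
    filter_upwards [φ.jetChart.open_target.mem_nhds (φ.jetChart.map_source hz)] with x hx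
    exact h _ (φ.jetProj_symm_mem hx)
  rw [dqt, dqt, h1.fderiv_eq]

/-- Product rule: since `∂^t_i q^j_t = δ^j_i`, differentiating the coefficients `q^j_t` leaves the
single extra term `g i z`. -/
lemma BundleChart.dqt_add_sum {f : J1 B → ℝ} {g : Fin m → J1 B → ℝ} {z : J1 B}
    (hz : jetProj B z ∈ φ.coord.source)
    (hf : DifferentiableAt ℝ (f ∘ φ.jetChart.symm) (φ.jetChart z))
    (hg : ∀ j, DifferentiableAt ℝ (g j ∘ φ.jetChart.symm) (φ.jetChart z)) (i : Fin m) :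
    dqt φ i (fun y => f y + ∑ j, qt φ j y * g j y) z =
      dqt φ i f z + ∑ j, qt φ j z * dqt φ i (g j) z + g i z := by
  have hq : ∀ j, HasFDerivAt (qt φ j ∘ φ.jetChart.symm)
      ((EuclideanSpace.proj j : Fib m →L[ℝ] ℝ).comp (ContinuousLinearMap.snd ℝ (Base m) (Fib m)))
      (φ.jetChart z) := by
    intro j
    refine (((EuclideanSpace.proj j : Fib m →L[ℝ] ℝ).comp
      (ContinuousLinearMap.snd ℝ (Base m) (Fib m))).hasFDerivAt).congr_of_eventuallyEq ?_
    filter_upwards [φ.jetChart.open_target.mem_nhds (φ.jetChart.map_source hz)] with x hx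
    change (φ.jetChart (φ.jetChart.symm x)).2 j = x.2 j
    rw [φ.jetChart.right_inv hx]
  have h := hf.hasFDerivAt.add
    (HasFDerivAt.fun_sum (u := Finset.univ) fun j _ => (hq j).mul (hg j).hasFDerivAt)
  have h2 : dqt φ i (fun y => f y + ∑ j, qt φ j y * g j y) z = _ :=
    DFunLike.congr_fun h.fderiv ((0 : Base m), EuclideanSpace.single i (1 : ℝ))
  rw [h2]
  simp [φ.jetChart.left_inv (x := z) hz, Finset.sum_add_distrib, dqt, add_assoc]

/-- Differentiating `ξ_γ^k` yields the right side of the symmetry condition plus one more copy of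
`γ^k_i`; the factor `1 / 2` absorbs that copy. -/
lemma DynamicConnection.isSymmetric_iff (γ : DynamicConnection B) :
    γ.IsSymmetric ↔ ∀ (φ : BundleChart B) (z : J1 B), jetProj B z ∈ φ.coord.source →
      ∀ i k : Fin m, gammaSpace φ γ k i z =
        (1 / 2) * dqt φ i (xiComp φ γ.toHolonomic k) z := by
  refine forall_congr' fun φ => forall_congr' fun z => forall_congr' fun hz =>
    forall_congr' fun i => forall_congr' fun k => ?_
  rw [φ.dqt_congr (fun y hy => φ.xiComp_toHolonomic γ hy k) hz,
    φ.dqt_add_sum (f := gammaTime φ γ k) (g := gammaSpace φ γ k) hz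
      (φ.differentiableAt_lift γ hz _ k) fun j => φ.differentiableAt_lift γ hz _ k]
  constructor <;> intro h <;> linarith

lemma HolonomicConnection.toDynamic_isSymmetric (ξ : HolonomicConnection B) :
    ξ.toDynamic.IsSymmetric := by
  rw [DynamicConnection.isSymmetric_iff]
  intro φ z hz i k
  rw [φ.gammaSpace_toDynamic ξ hz]
  -- It remains to see that `γ_ξ` induces `ξ` again: the two terms `½ q^j_t ∂^t_j ξ^k` cancel in
  -- `γ^k_0 + q^j_t γ^k_j`.
  congr 1
  refine φ.dqt_congr (fun y hy => ?_) hz i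
  rw [φ.xiComp_toHolonomic _ hy, φ.gammaTime_toDynamic ξ hy]
  simp only [φ.gammaSpace_toDynamic ξ hy, Finset.mul_sum]
  rw [sub_add, sub_eq_self.2]
  rw [sub_eq_zero]
  exact Finset.sum_congr rfl fun j _ => by ring

lemma DynamicConnection.eq_toDynamic_toHolonomic_iff (γ : DynamicConnection B) :
    γ = γ.toHolonomic.toDynamic ↔ γ.IsSymmetric := by
  refine ⟨fun h => h ▸ γ.toHolonomic.toDynamic_isSymmetric, fun h => ?_⟩
  rw [isSymmetric_iff] at h
  refine ext_components fun φ z hz i => ⟨?_, fun j => ?_⟩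
  -- The time component is determined by `γ^i_0 = ξ_γ^i - q^j_t γ^i_j`, once symmetry has fixed the
  -- `γ^i_j`.
  · rw [φ.gammaTime_toDynamic _ hz, φ.xiComp_toHolonomic γ hz, eq_sub_iff_add_eq, Finset.mul_sum]
    congr 1
    refine Finset.sum_congr rfl fun j _ => ?_
    rw [h φ z hz j i]
    ring
  · rw [φ.gammaSpace_toDynamic _ hz, h φ z hz j i]

end Components

end TimeMech

end

theorem proposition4p2 {m : ℕ}
    {M : Type*} [TopologicalSpace M] [ChartedSpace (TimeMech.Fib m) M]
    [IsManifold 𝓘(ℝ, TimeMech.Fib m) ∞ M]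
    {Q : Type*} [TopologicalSpace Q] [ChartedSpace (TimeMech.Base m) Q]
    [IsManifold 𝓘(ℝ, TimeMech.Base m) ∞ Q]
    (B : TimeMech.TimeBundle m M Q) :
    ∃ G : TimeMech.HolonomicConnection B → TimeMech.DynamicConnection B,
      -- the components of `γ_ξ = G ξ` in all bundle coordinates
      (∀ (ξ : TimeMech.HolonomicConnection B) (φ : TimeMech.BundleChart B) (z : TimeMech.J1 B),
        TimeMech.jetProj B z ∈ φ.coord.source → ∀ i : Fin m,
          TimeMech.gammaTime φ (G ξ) i z = TimeMech.xiComp φ ξ i z -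
            (1 / 2) * ∑ j, TimeMech.qt φ j z * TimeMech.dqt φ j (TimeMech.xiComp φ ξ i) z ∧
          ∀ j : Fin m, TimeMech.gammaSpace φ (G ξ) i j z =
            (1 / 2) * TimeMech.dqt φ j (TimeMech.xiComp φ ξ i) z) ∧
      -- the global construction of `γ_ξ` from `I_ξ(u) = [ξ, v̂(u)] - v̂([ξ, u])`
      (∀ ξ : TimeMech.HolonomicConnection B,
        ∃ I : TimeMech.VerticalEndo B, TimeMech.IsBracketEndo ξ I ∧
          (∀ I' : TimeMech.VerticalEndo B, TimeMech.IsBracketEndo ξ I' → I' = I) ∧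
          ∀ (z : TimeMech.J1 B) (w : TimeMech.TJ z), (G ξ).vertProj z w =
            (((1 / 2 : ℝ) • (I z (ξ.vertProj z w) + ξ.vertProj z w) : TimeMech.VJ z) :
              TimeMech.TJ z)) ∧
      -- symmetry
      (∀ ξ : TimeMech.HolonomicConnection B, (G ξ).IsSymmetric) ∧
      ∀ γ : TimeMech.DynamicConnection B, γ = G γ.toHolonomic ↔ γ.IsSymmetric := by
  exact ⟨fun ξ => ξ.toDynamic,
    fun ξ φ z hz i => ⟨φ.gammaTime_toDynamic ξ hz i, φ.gammaSpace_toDynamic ξ hz i⟩,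
    fun ξ => ⟨ξ.bracketEndo, ξ.isBracketEndo_bracketEndo,
      fun _ hI => ξ.isBracketEndo_bracketEndo.unique hI, ξ.toDynamic_vertProj⟩,
    fun ξ => ξ.toDynamic_isSymmetric, fun γ => γ.eq_toDynamic_toHolonomic_iff⟩
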